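/- For a group $G$ and $A\subset G$, let $\Gamma(G,A)$ be the (undirected) Cayley graph with vertex set $G$ and edge set $\{(ag,g) : g\in G,\ a\in A\}$, and let the diameter of a graph be the maximum, over all pairs of vertices, of the length of a shortest path between them. For a prime $p$, let $G_p = \mathrm{SL}_2(\mathbb{Z}/p\mathbb{Z})$ and let $\mathscr{C}_p$ be the set of all pairs $(g,h)\in G_p^2$ such that $g$ and $h$ generate $G_p$. There are an absolute constant $C>0$ and, for every prime $p$, a subset $E_p\subset \mathscr{C}_p$ such that $|E_p| = o(|\mathscr{C}_p|)$ as $p\to\infty$, and such that, for every prime $p$ and all $(g,h)\in \mathscr{C}_p\setminus E_p$, $$\operatorname{diam}(\Gamma(G_p,\{g,h\})) \leq C \log p .$$ -/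

import Mathlib

open Filter Asymptotics
open scoped MatrixGroups

/-- The Cayley graph `Γ(G, A)`: its vertices are the elements of `G` and its edges are the pairs
`(a * g, g)` with `g ∈ G` and `a ∈ A`. It is undirected, and the edges `(g, g)` that arise when
`1 ∈ A` are left out, which has no effect on distances. -/
def leftCayleyGraph {G : Type*} [Group G] (A : Set G) : SimpleGraph G :=
  SimpleGraph.fromRel (fun x y => ∃ a ∈ A, x = a * y)

/-- The set of all pairs `(g, h)` of elements of `G` such that `g` and `h` generate `G`. -/
def generatingPairs (G : Type*) [Group G] : Set (G × G) :=
  {x | Subgroup.closure {x.1, x.2} = ⊤}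

/-! ### Elementary computations in `SL(2, F)` -/

section Basic

variable {F : Type*} [Field F]

/-! Let S = {1, g, g⁻¹, h, h⁻¹} and G = SL(2, p), and let A run through powers of S. For all but few
generating pairs, words of length about log p / 24 give at least p^(1/40) elements. A bounded number
of twelvefold products then brings |A| above about p^(11/4), and a set of that size fills G in forty
factors. The total length is O(log p).

Start. Multiply both entries of a pair on the right by the unipotent `upperU s`. For a pair in
general position the difference of two distinct words of length n then has a matrix entry that is a
nonzero polynomial in s of degree at most n, so collisions are rare (`card_wordVal_eq_le`,
`card_pairCollides_le`).

Growth (`card_growth`). A set A that fixes no point of the projective line has O(|A³|^(2/3))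
elements of a given trace t ≠ 0, ±2 (`card_trace_pow_three_le`). By orbit counting, the centraliser
of such an element therefore meets A² in many elements. If this held for a torus but failed for its
conjugate by an element of A, then A⁵ would be large; so either A grows or every conjugate torus is
rich. Conjugate tori share no regular elements and there are about p² of them, so in the second case
A¹² is large.

End (`mem_pow_of_large`). A point-line incidence bound solves l²y + u + y' = s with data from A²,
which puts every unipotent `upperU s` into A¹⁰. The same holds for lower unipotents, and four
unipotents, alternately upper and lower, give any element of G.

Exceptional set. At most 10 p^(5 + 1/8) pairs are bad. No classification of subgroups is needed to
compare this with the generating pairs: if g^j h is a transvection at a point moved by g, then g and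
h generate G, and letting j run up to about p^(1/4) yields a constant times p^(5 + 1/4) such pairs
(`le_card_generatingPairs`). -/

theorem SL2.mul_apply (g h : SL(2, F)) (i j : Fin 2) :
    (g * h).1 i j = g.1 i 0 * h.1 0 j + g.1 i 1 * h.1 1 j := by
  simp [Matrix.mul_apply, Fin.sum_univ_two]

theorem SL2.inv_apply (g : SL(2, F)) :
    g⁻¹.1 0 0 = g.1 1 1 ∧ g⁻¹.1 0 1 = -g.1 0 1 ∧ g⁻¹.1 1 0 = -g.1 1 0 ∧ g⁻¹.1 1 1 = g.1 0 0 := by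
  rw [Matrix.SpecialLinearGroup.SL2_inv_expl]
  simp

theorem SL2.det_eq (g : SL(2, F)) : g.1 0 0 * g.1 1 1 - g.1 0 1 * g.1 1 0 = 1 := by
  have := g.2
  rwa [Matrix.det_fin_two] at this

theorem SL2.ext {g h : SL(2, F)} (h00 : g.1 0 0 = h.1 0 0) (h01 : g.1 0 1 = h.1 0 1)
    (h10 : g.1 1 0 = h.1 1 0) (h11 : g.1 1 1 = h.1 1 1) : g = h := by
  apply Subtype.ext
  ext i j
  fin_cases i <;> fin_cases j <;> assumption

theorem SL2.one_apply : (1 : SL(2, F)).1 0 0 = 1 ∧ (1 : SL(2, F)).1 0 1 = 0 ∧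
    (1 : SL(2, F)).1 1 0 = 0 ∧ (1 : SL(2, F)).1 1 1 = 1 := by
  simp

/-- The trace of an element of `SL(2, F)`. -/
def SL2.tr (g : SL(2, F)) : F := g.1 0 0 + g.1 1 1

theorem SL2.tr_conj (g h : SL(2, F)) : SL2.tr (g * h * g⁻¹) = SL2.tr h := by
  have hd := SL2.det_eq g
  obtain ⟨i1, i2, i3, i4⟩ := SL2.inv_apply g
  simp only [SL2.tr, SL2.mul_apply, i1, i2, i3, i4]
  linear_combination (h.1 0 0 + h.1 1 1) * hd

theorem card_le_two_of_quadratic (s : Finset F) (a b c : F) (h : ¬ (a = 0 ∧ b = 0 ∧ c = 0))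
    (hs : ∀ x ∈ s, a * x ^ 2 + b * x + c = 0) : s.card ≤ 2 := by
  by_contra! hc
  obtain ⟨x, hx, y, hy, z, hz, hxy, hxz, hyz⟩ := Finset.two_lt_card.mp hc
  have ex := hs x hx
  have ey := hs y hy
  have ez := hs z hz
  have e1 : a * (x + y) + b = 0 := by
    apply mul_left_cancel₀ (sub_ne_zero.mpr hxy)
    linear_combination ex - ey
  have e2 : a * (x + z) + b = 0 := by
    apply mul_left_cancel₀ (sub_ne_zero.mpr hxz)
    linear_combination ex - ez
  have ha : a = 0 := by
    apply mul_left_cancel₀ (sub_ne_zero.mpr hyz)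
    linear_combination e1 - e2
  have hb : b = 0 := by simpa [ha] using e1
  exact h ⟨ha, hb, by simpa [ha, hb] using ex⟩

/-- An element of `SL(2, F)` whose first column spans the given point of the projective line. -/
def frame : Option F → SL(2, F)
  | none => 1
  | some x => ⟨!![x, -1; 1, 0], by simp [Matrix.det_fin_two_of]⟩

/-- `v` fixes the point `e` of the projective line. -/
def Fixes (e : Option F) (v : SL(2, F)) : Prop := ((frame e)⁻¹ * v * frame e).1 1 0 = 0

theorem fixes_none (v : SL(2, F)) : Fixes none v ↔ v.1 1 0 = 0 := by
  simp [Fixes, frame]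

theorem fixes_some (x : F) (v : SL(2, F)) :
    Fixes (some x) v ↔ v.1 1 0 * x ^ 2 + (v.1 1 1 - v.1 0 0) * x - v.1 0 1 = 0 := by
  obtain ⟨i1, i2, i3, i4⟩ := SL2.inv_apply (frame (some x))
  simp only [Fixes, SL2.mul_apply, i3, i4]
  simp only [frame, Matrix.of_apply, Matrix.cons_val_zero, Matrix.cons_val_one,
    Matrix.cons_val', Matrix.cons_val_fin_one]
  constructor <;> intro h <;> linear_combination h

theorem card_fixes_le [Fintype F] [DecidableEq F] (v : SL(2, F)) (s : Finset (Option F))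
    (hs : ∀ e ∈ s, Fixes e v) (hv : SL2.tr v ^ 2 ≠ 4) : s.card ≤ 3 := by
  have h1 : s.eraseNone.card ≤ 2 := by
    apply card_le_two_of_quadratic _ (v.1 1 0) (v.1 1 1 - v.1 0 0) (-v.1 0 1)
    · rintro ⟨h1, h2, h3⟩
      apply hv
      have hd := SL2.det_eq v
      have h4 : v.1 1 1 = v.1 0 0 := sub_eq_zero.mp h2
      rw [h1, h4] at hd
      rw [SL2.tr, h4]
      linear_combination 4 * hd
    · intro x hx
      have := (fixes_some x v).mp (hs _ (Finset.mem_eraseNone.mp hx))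
      linear_combination this
  have h2 : s.card ≤ s.eraseNone.card + 1 := by
    have : s ⊆ insert none (s.eraseNone.map Function.Embedding.some) := by
      intro e he
      cases e with
      | none => simp
      | some x => simpa using he
    calc s.card ≤ _ := Finset.card_le_card this
      _ ≤ _ := (Finset.card_insert_le _ _).trans (by rw [Finset.card_map])
  omega

/-- Since `a` lies in the big Bruhat cell, the upper left entry of the product determines the free
off-diagonal entry of the left factor once the diagonal is known. -/
theorem bruhat_injective {l : F} {a s₁ s₂ r₁ r₂ : SL(2, F)} (ha : a.1 1 0 ≠ 0)
    (hs₁ : s₁.1 1 0 = 0) (hs₂ : s₂.1 1 0 = 0) (hr₁ : r₁.1 1 0 = 0) (hr₂ : r₂.1 1 0 = 0)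
    (ls₁ : s₁.1 0 0 = l) (ls₂ : s₂.1 0 0 = l) (lr₁ : r₁.1 0 0 = l) (lr₂ : r₂.1 0 0 = l)
    (h : s₁ * a * s₂ = r₁ * a * r₂) : s₁ = r₁ ∧ s₂ = r₂ := by
  have d1 := SL2.det_eq s₁
  have d2 := SL2.det_eq r₁
  rw [hs₁, ls₁] at d1
  rw [hr₁, lr₁] at d2
  have hl : l ≠ 0 := by rintro rfl; simp at d1
  have h00 := congrArg (fun m : SL(2, F) => m.1 0 0) h
  simp only [SL2.mul_apply, hs₂, hr₂, ls₁, ls₂, lr₁, lr₂] at h00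
  have hx : s₁.1 0 1 = r₁.1 0 1 := by
    apply mul_left_cancel₀ (mul_ne_zero hl ha)
    linear_combination h00
  have hy : s₁.1 1 1 = r₁.1 1 1 := by
    apply mul_left_cancel₀ hl
    linear_combination d1 - d2
  have e : s₁ = r₁ := SL2.ext (by rw [ls₁, lr₁]) hx (by rw [hs₁, hr₁]) hy
  exact ⟨e, by subst e; exact mul_left_cancel h⟩

/-- Such a `Z` is nilpotent of rank one, so its image equals its kernel. The condition on `v` is
tr(vZ) = 0, which says that `v` maps this line into itself. -/
theorem nilpotent_fixes (Z : Matrix (Fin 2) (Fin 2) F) (hZ : Z ≠ 0) (htr : Z 0 0 + Z 1 1 = 0)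
    (hdet : Z 0 0 * Z 1 1 - Z 0 1 * Z 1 0 = 0) :
    ∃ e : Option F, ∀ v : SL(2, F),
      v.1 0 0 * Z 0 0 + v.1 0 1 * Z 1 0 + v.1 1 0 * Z 0 1 + v.1 1 1 * Z 1 1 = 0 → Fixes e v := by
  have h11 : Z 1 1 = -Z 0 0 := by linear_combination htr
  rw [h11] at hdet
  by_cases hr : Z 1 0 = 0
  · refine ⟨none, fun v hv => (fixes_none v).mpr ?_⟩
    rw [hr] at hdet
    have h0 : Z 0 0 = 0 := by
      have : Z 0 0 ^ 2 = 0 := by linear_combination -hdet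
      exact pow_eq_zero_iff (two_ne_zero) |>.mp this
    have h01 : Z 0 1 ≠ 0 := by
      intro h01
      apply hZ
      ext i j
      fin_cases i <;> fin_cases j <;> simp [h0, h01, hr, h11]
    rw [h11, h0, hr] at hv
    apply mul_right_cancel₀ h01
    linear_combination hv
  · refine ⟨some (Z 0 0 / Z 1 0), fun v hv => (fixes_some _ v).mpr ?_⟩
    field_simp
    rw [h11] at hv
    linear_combination -Z 1 0 * hv - v.1 1 0 * hdet

theorem orthogonal_dependent (v : Fin 3 → Fin 4 → F) (hv : LinearIndependent F v) (z w : Fin 4 → F)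
    (hz : ∀ i, ∑ j, v i j * z j = 0) (hw : ∀ i, ∑ j, v i j * w j = 0) (hz0 : z ≠ 0) :
    ∃ c : F, w = c • z := by
  let M : Matrix (Fin 3) (Fin 4) F := Matrix.of v
  have hr : M.rank = 3 := by
    have := LinearIndependent.rank_matrix (M := M) hv
    simpa using this
  have hn := LinearMap.finrank_range_add_finrank_ker M.mulVecLin
  rw [← Matrix.rank, hr] at hn
  have hk : Module.finrank F (LinearMap.ker M.mulVecLin) ≤ 1 := by
    simp at hn
    omega
  obtain ⟨u, hu⟩ := finrank_le_one_iff.mp hk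
  have memz : z ∈ LinearMap.ker M.mulVecLin := by
    rw [LinearMap.mem_ker]; ext i; exact hz i
  have memw : w ∈ LinearMap.ker M.mulVecLin := by
    rw [LinearMap.mem_ker]; ext i; exact hw i
  obtain ⟨c, hc⟩ := hu ⟨z, memz⟩
  obtain ⟨d, hd⟩ := hu ⟨w, memw⟩
  have hc' : c • (u : Fin 4 → F) = z := congrArg Subtype.val hc
  have hd' : d • (u : Fin 4 → F) = w := congrArg Subtype.val hd
  have hc0 : c ≠ 0 := by
    rintro rfl
    exact hz0 (by rw [← hc', zero_smul])
  exact ⟨d * c⁻¹, by rw [← hc', ← hd', smul_smul, mul_assoc, inv_mul_cancel₀ hc0, mul_one]⟩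

end Basic

/-! ### Right translations that keep three traces -/

section TraceFibre

variable {F : Type*} [Field F]

/-- Here y - 1 is nilpotent and tr(v(y - 1)) = 0 for each of the three matrices, so they all fix its
image. -/
theorem fixes_of_sub_one {v₀ v₁ v₂ : SL(2, F)} (y : SL(2, F)) (hy : y ≠ 1)
    (htr : SL2.tr y = 2)
    (h₀ : SL2.tr (v₀ * y) = SL2.tr v₀) (h₁ : SL2.tr (v₁ * y) = SL2.tr v₁)
    (h₂ : SL2.tr (v₂ * y) = SL2.tr v₂) : ∃ e, Fixes e v₀ ∧ Fixes e v₁ ∧ Fixes e v₂ := by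
  have hd := SL2.det_eq y
  simp only [SL2.tr, SL2.mul_apply] at htr h₀ h₁ h₂
  have hy' : y.1 - 1 ≠ 0 := fun h => hy (Subtype.ext (sub_eq_zero.mp h))
  obtain ⟨e, he⟩ := nilpotent_fixes (y.1 - 1) hy'
    (by simp; linear_combination htr)
    (by simp; linear_combination hd - htr)
  simp at he
  exact ⟨e, he v₀ (by linear_combination h₀), he v₁ (by linear_combination h₁),
    he v₂ (by linear_combination h₂)⟩

/-- Three dependent matrices of equal trace are collinear. Their determinants being 1 makes v₀⁻¹v₁
unipotent, and right translation by it keeps all three traces. -/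
theorem fixes_of_dependent {t : F} (ht : t ≠ 0) {v₀ v₁ v₂ : SL(2, F)} (t₀ : SL2.tr v₀ = t)
    (t₁ : SL2.tr v₁ = t) (t₂ : SL2.tr v₂ = t) (h01 : v₀ ≠ v₁) (h02 : v₀ ≠ v₂) (h12 : v₁ ≠ v₂)
    {a b c : F} (habc : ¬ (a = 0 ∧ b = 0 ∧ c = 0))
    (h : ∀ i j, a * v₀.1 i j + b * v₁.1 i j + c * v₂.1 i j = 0) :
    ∃ e, Fixes e v₀ ∧ Fixes e v₁ ∧ Fixes e v₂ := by
  -- Taking traces in the relation gives (a + b + c)t = 0.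
  have hsum : a + b + c = 0 := by
    apply mul_right_cancel₀ ht
    have e1 := h 0 0
    have e2 := h 1 1
    rw [SL2.tr] at t₀ t₁ t₂
    linear_combination e1 + e2 - a * t₀ - b * t₁ - c * t₂
  have hc : c ≠ 0 := by
    rintro rfl
    have hb : b = -a := by linear_combination hsum
    have ha : a ≠ 0 := by rintro rfl; exact habc ⟨rfl, by simpa using hb, rfl⟩
    apply h01
    have : ∀ i j, v₀.1 i j = v₁.1 i j := fun i j => by
      apply mul_left_cancel₀ ha
      have := h i j
      rw [hb] at this
      linear_combination this
    exact SL2.ext (this _ _) (this _ _) (this _ _) (this _ _)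
  obtain ⟨β, hβ⟩ : ∃ β, β = -b / c := ⟨_, rfl⟩
  have hv2 : ∀ i j, v₂.1 i j = v₀.1 i j + β * (v₁.1 i j - v₀.1 i j) := fun i j => by
    have := h i j
    have ha : a = -b - c := by linear_combination hsum
    rw [ha] at this
    rw [hβ]
    field_simp
    linear_combination this
  have hβ0 : β ≠ 0 := by
    rintro rfl
    exact h02 (SL2.ext (by simp [hv2]) (by simp [hv2]) (by simp [hv2]) (by simp [hv2]))
  have hβ1 : β - 1 ≠ 0 := by
    intro h1
    have : β = 1 := by linear_combination h1
    subst this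
    exact h12 (SL2.ext (by simp [hv2]) (by simp [hv2]) (by simp [hv2]) (by simp [hv2]))
  have d0 := SL2.det_eq v₀
  have d1 := SL2.det_eq v₁
  have d2 := SL2.det_eq v₂
  simp only [hv2] at d2
  obtain ⟨i1, i2, i3, i4⟩ := SL2.inv_apply v₀
  -- The determinant at parameter β on the line is 1 + β(1 - β)(tr(v₀⁻¹v₁) - 2).
  have hy : SL2.tr (v₀⁻¹ * v₁) = 2 := by
    apply mul_left_cancel₀ (mul_ne_zero hβ0 hβ1)
    simp only [SL2.tr, SL2.mul_apply, i1, i2, i3, i4]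
    linear_combination -d2 + (1 - β) ^ 2 * d0 + β ^ 2 * d1
  -- Cayley–Hamilton gives y² = 2y - 1 for y = v₀⁻¹v₁, and v₁y = v₀y².
  have hch : ∀ i j, (v₁ * (v₀⁻¹ * v₁)).1 i j = 2 * v₁.1 i j - v₀.1 i j := by
    simp only [SL2.tr, SL2.mul_apply, i1, i2, i3, i4] at hy
    have : v₁ * (v₀⁻¹ * v₁) = v₀ * (v₀⁻¹ * v₁) * (v₀⁻¹ * v₁) := by group
    rw [this]
    set y := v₀⁻¹ * v₁ with hyy
    have hv1 : v₁ = v₀ * y := by rw [hyy]; group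
    have dy := SL2.det_eq y
    have hty : y.1 0 0 + y.1 1 1 = 2 := by
      rw [hyy]; simp only [SL2.mul_apply, i1, i2, i3, i4]; linear_combination hy
    have h11 : y.1 1 1 = 2 - y.1 0 0 := by linear_combination hty
    rw [h11] at dy
    intro i j
    rw [hv1]
    simp only [SL2.mul_apply]
    fin_cases j
    · simp only [Fin.zero_eta, h11]
      linear_combination -v₀.1 i 0 * dy
    · simp only [Fin.mk_one, h11]
      linear_combination -v₀.1 i 1 * dy
  refine fixes_of_sub_one (v₀⁻¹ * v₁) ?_ hy ?_ ?_ ?_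
  · intro h
    exact h01 (inv_mul_eq_one.mp h)
  · rw [mul_inv_cancel_left, t₀, t₁]
  · rw [SL2.tr, hch, hch, t₁]
    rw [SL2.tr] at t₀ t₁
    linear_combination 2 * t₁ - t₀
  · rw [t₂, SL2.tr, SL2.mul_apply v₂, SL2.mul_apply v₂]
    simp only [hv2]
    have e00 := hch 0 0
    have e11 := hch 1 1
    have f00 : (v₀ * (v₀⁻¹ * v₁)).1 0 0 = v₁.1 0 0 := by rw [mul_inv_cancel_left]
    have f11 : (v₀ * (v₀⁻¹ * v₁)).1 1 1 = v₁.1 1 1 := by rw [mul_inv_cancel_left]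
    rw [SL2.mul_apply] at e00 e11 f00 f11
    rw [SL2.tr] at t₀ t₁
    linear_combination (1 - β) * (f00 + f11) + β * (e00 + e11) + (1 + β) * t₁ - β * t₀

/-- The conditions say that y - 1 and w - 1 are orthogonal to the three matrices under the trace
form. If these are independent the two differences are proportional, which makes y unipotent;
otherwise `fixes_of_dependent` applies. -/
theorem fixes_of_three_solutions {t : F} (ht : t ≠ 0) {v₀ v₁ v₂ : SL(2, F)} (t₀ : SL2.tr v₀ = t)
    (t₁ : SL2.tr v₁ = t) (t₂ : SL2.tr v₂ = t) (h01 : v₀ ≠ v₁) (h02 : v₀ ≠ v₂) (h12 : v₁ ≠ v₂)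
    {y w : SL(2, F)} (hy : y ≠ 1) (hw : w ≠ 1) (hyw : y ≠ w)
    (hy₀ : SL2.tr (v₀ * y) = t) (hy₁ : SL2.tr (v₁ * y) = t) (hy₂ : SL2.tr (v₂ * y) = t)
    (hw₀ : SL2.tr (v₀ * w) = t) (hw₁ : SL2.tr (v₁ * w) = t) (hw₂ : SL2.tr (v₂ * w) = t) :
    ∃ e, Fixes e v₀ ∧ Fixes e v₁ ∧ Fixes e v₂ := by
  let fl : SL(2, F) → Fin 4 → F := fun v => ![v.1 0 0, v.1 0 1, v.1 1 0, v.1 1 1]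
  let gl : SL(2, F) → Fin 4 → F := fun v => ![v.1 0 0 - 1, v.1 1 0, v.1 0 1, v.1 1 1 - 1]
  have orth : ∀ v z : SL(2, F), SL2.tr v = t → SL2.tr (v * z) = t →
      ∑ j, fl v j * gl z j = 0 := by
    intro v z h1 h2
    simp only [SL2.tr, SL2.mul_apply] at h1 h2
    simp [fl, gl, Fin.sum_univ_four]
    linear_combination h2 - h1
  by_cases hli : LinearIndependent F ![fl v₀, fl v₁, fl v₂]
  · have gne : gl y ≠ 0 := by
      intro h
      have a0 := congrFun h 0
      have a1 := congrFun h 1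
      have a2 := congrFun h 2
      have a3 := congrFun h 3
      simp [gl] at a0 a1 a2 a3
      apply hy
      refine SL2.ext ?_ ?_ ?_ ?_ <;> simp [a1, a2, sub_eq_zero.mp a0, sub_eq_zero.mp a3]
    obtain ⟨c, hc⟩ := orthogonal_dependent _ hli (gl y) (gl w)
      (by
        intro i
        fin_cases i
        · exact orth _ _ t₀ hy₀
        · exact orth _ _ t₁ hy₁
        · exact orth _ _ t₂ hy₂)
      (by
        intro i
        fin_cases i
        · exact orth _ _ t₀ hw₀
        · exact orth _ _ t₁ hw₁
        · exact orth _ _ t₂ hw₂) gne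
    have a0 : w.1 0 0 - 1 = c * (y.1 0 0 - 1) := by simpa [gl] using congrFun hc 0
    have a1 : w.1 1 0 = c * y.1 1 0 := by simpa [gl] using congrFun hc 1
    have a2 : w.1 0 1 = c * y.1 0 1 := by simpa [gl] using congrFun hc 2
    have a3 : w.1 1 1 - 1 = c * (y.1 1 1 - 1) := by simpa [gl] using congrFun hc 3
    have a0' : w.1 0 0 = 1 + c * (y.1 0 0 - 1) := by linear_combination a0
    have a3' : w.1 1 1 = 1 + c * (y.1 1 1 - 1) := by linear_combination a3
    have hc0 : c ≠ 0 := by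
      rintro rfl
      apply hw
      refine SL2.ext ?_ ?_ ?_ ?_ <;> simp [a0', a1, a2, a3']
    have hc1 : 1 - c ≠ 0 := by
      intro h1
      have : c = 1 := by linear_combination -h1
      subst this
      apply hyw
      refine SL2.ext ?_ ?_ ?_ ?_ <;> simp [a0', a1, a2, a3']
    have dy := SL2.det_eq y
    have dw := SL2.det_eq w
    rw [a0', a1, a2, a3'] at dw
    -- With Z = y - 1, det(1 + Z) = det(1 + cZ) = 1 gives c(1 - c) tr Z = 0.
    refine fixes_of_sub_one y hy ?_ (by rw [hy₀, t₀]) (by rw [hy₁, t₁]) (by rw [hy₂, t₂])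
    apply mul_left_cancel₀ (mul_ne_zero hc0 hc1)
    rw [SL2.tr]
    linear_combination dw - c ^ 2 * dy
  · obtain ⟨g, hg, i, hi⟩ := Fintype.not_linearIndependent_iff.mp hli
    simp only [Fin.sum_univ_three] at hg
    have b0 := congrFun hg 0
    have b1 := congrFun hg 1
    have b2 := congrFun hg 2
    have b3 := congrFun hg 3
    simp [fl] at b0 b1 b2 b3
    refine fixes_of_dependent ht t₀ t₁ t₂ h01 h02 h12 (a := g 0) (b := g 1) (c := g 2) ?_ ?_
    · rintro ⟨r0, r1, r2⟩
      fin_cases i <;> simp_all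
    · intro i j
      fin_cases i <;> fin_cases j <;> simp <;> assumption

end TraceFibre

/-! ### Few elements of a given trace -/

section TraceBound

open scoped Pointwise

variable {F : Type*} [Field F] [DecidableEq F]

open Classical in
-- In a basis adapted to `e` these elements are upper triangular, and their first diagonal entry is
-- a root of X² - tX + 1. For a fixed root, (x, y) ↦ x * a * y is injective into A³ when `a` moves
-- `e`, so each root accounts for at most √|A³| elements.
theorem card_trace_fixes_le (A : Finset SL(2, F)) (e : Option F) (he : ∃ a ∈ A, ¬ Fixes e a)
    (t : F) : (A.filter fun v => SL2.tr v = t ∧ Fixes e v).card ≤ 2 * Nat.sqrt (A ^ 3).card := by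
  obtain ⟨a, ha, hea⟩ := he
  set T := A.filter fun v => SL2.tr v = t ∧ Fixes e v with hT
  let k := frame e
  let f : SL(2, F) → F := fun v => (k⁻¹ * v * k).1 0 0
  have htr : ∀ v, SL2.tr (k⁻¹ * v * k) = SL2.tr v := fun v => by
    have := SL2.tr_conj k⁻¹ v
    rwa [inv_inv] at this
  have himage : (T.image f).card ≤ 2 := by
    apply card_le_two_of_quadratic _ 1 (-t) 1 (by simp)
    intro x hx
    obtain ⟨v, hv, rfl⟩ := Finset.mem_image.mp hx
    obtain ⟨-, hv1, hv2⟩ := Finset.mem_filter.mp hv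
    have hd := SL2.det_eq (k⁻¹ * v * k)
    have hv2' : (k⁻¹ * v * k).1 1 0 = 0 := hv2
    have h1 := htr v
    rw [hv1, SL2.tr] at h1
    rw [hv2'] at hd
    simp only [f]
    linear_combination (k⁻¹ * v * k).1 0 0 * h1 - hd
  have hfib : ∀ l ∈ T.image f, (T.filter fun v => f v = l).card ≤ Nat.sqrt (A ^ 3).card := by
    intro l _
    rw [Nat.le_sqrt, ← Finset.card_product]
    have prop : ∀ v ∈ T.filter fun v => f v = l,
        v ∈ A ∧ (k⁻¹ * v * k).1 1 0 = 0 ∧ (k⁻¹ * v * k).1 0 0 = l := by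
      intro v hv
      obtain ⟨h1, h2⟩ := Finset.mem_filter.mp hv
      obtain ⟨h3, -, h5⟩ := Finset.mem_filter.mp h1
      exact ⟨h3, h5, h2⟩
    apply Finset.card_le_card_of_injOn (fun p => p.1 * a * p.2)
    · rintro ⟨x, y⟩ hxy
      obtain ⟨hx, hy⟩ := Finset.mem_product.mp (Finset.mem_coe.mp hxy)
      have : A ^ 3 = A * A * A := by rw [pow_succ, pow_two]
      rw [Finset.mem_coe, this]
      exact Finset.mul_mem_mul (Finset.mul_mem_mul (prop x hx).1 ha) (prop y hy).1
    · rintro ⟨x, y⟩ hxy ⟨x', y'⟩ hxy' h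
      obtain ⟨hx, hy⟩ := Finset.mem_product.mp (Finset.mem_coe.mp hxy)
      obtain ⟨hx', hy'⟩ := Finset.mem_product.mp (Finset.mem_coe.mp hxy')
      simp only at h hx hy hx' hy'
      obtain ⟨-, x1, x2⟩ := prop x hx
      obtain ⟨-, y1, y2⟩ := prop y hy
      obtain ⟨-, x1', x2'⟩ := prop x' hx'
      obtain ⟨-, y1', y2'⟩ := prop y' hy'
      have hk : (k⁻¹ * x * k) * (k⁻¹ * a * k) * (k⁻¹ * y * k) =
          (k⁻¹ * x' * k) * (k⁻¹ * a * k) * (k⁻¹ * y' * k) := by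
        calc _ = k⁻¹ * (x * a * y) * k := by group
          _ = k⁻¹ * (x' * a * y') * k := by rw [h]
          _ = _ := by group
      obtain ⟨r1, r2⟩ := bruhat_injective hea x1 y1 x1' y1' x2 y2 x2' y2' hk
      have c1 : x = x' := mul_left_cancel (mul_right_cancel r1)
      have c2 : y = y' := mul_left_cancel (mul_right_cancel r2)
      rw [c1, c2]
  calc T.card ≤ Nat.sqrt (A ^ 3).card * (T.image f).card :=
        Finset.card_le_mul_card_image T _ hfib
    _ ≤ Nat.sqrt (A ^ 3).card * 2 := Nat.mul_le_mul_left _ himage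
    _ = _ := mul_comm _ _

open Classical in
/-- Few elements of `A` have a given trace, unless `A` fixes a point of the projective line. -/
theorem card_trace_pow_three_le [Fintype F] (A : Finset SL(2, F)) (h1 : 1 ∈ A)
    (hinv : ∀ a ∈ A, a⁻¹ ∈ A) (hfix : ∀ e, ∃ a ∈ A, ¬ Fixes e a) {t : F} (ht : t ≠ 0)
    (ht4 : t ^ 2 ≠ 4) : (A.filter fun v => SL2.tr v = t).card ^ 3 ≤ 4096 * (A ^ 3).card ^ 2 := by
  set S := A.filter fun v => SL2.tr v = t with hS
  set M := (A ^ 3).card with hM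
  set m := Nat.sqrt M with hm
  have memS : ∀ v ∈ S, v ∈ A ∧ SL2.tr v = t := fun v hv => Finset.mem_filter.mp hv
  have hMpos : 0 < M := Finset.card_pos.mpr ⟨1, by simpa using Finset.pow_mem_pow h1 (n := 3)⟩
  have hmpos : 1 ≤ m := Nat.le_sqrt.mpr hMpos
  have hmM : m ^ 2 ≤ M := by rw [pow_two]; exact Nat.sqrt_le M
  let good : SL(2, F) × SL(2, F) → SL(2, F) → Prop := fun p v =>
    v ≠ p.1 ∧ v ≠ p.2 ∧ ¬ ∃ e, Fixes e p.1 ∧ Fixes e p.2 ∧ Fixes e v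
  -- A bad third element repeats an entry of `p` or fixes one of at most three points fixed by
  -- `p.1`; each point carries at most 2m elements of trace t, and 2 + 3·2m ≤ 8m.
  have hbad : ∀ p ∈ S.offDiag, S.card ≤ (S.filter (good p)).card + 8 * m := by
    intro p hp
    obtain ⟨hp1, hp2, -⟩ := Finset.mem_offDiag.mp hp
    let P : Finset (Option F) := Finset.univ.filter fun e => Fixes e p.1
    have hP : P.card ≤ 3 := by
      apply card_fixes_le p.1 P
      · intro e he; exact (Finset.mem_filter.mp he).2
      · rw [(memS _ hp1).2]; exact ht4
    have hcov : S ⊆ S.filter (good p) ∪ ({p.1, p.2} ∪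
        P.biUnion fun e => A.filter fun v => SL2.tr v = t ∧ Fixes e v) := by
      intro v hv
      by_cases hg : good p v
      · exact Finset.mem_union_left _ (Finset.mem_filter.mpr ⟨hv, hg⟩)
      · apply Finset.mem_union_right
        by_cases hv1 : v = p.1
        · simp [hv1]
        by_cases hv2 : v = p.2
        · simp [hv2]
        apply Finset.mem_union_right
        have : ∃ e, Fixes e p.1 ∧ Fixes e p.2 ∧ Fixes e v := by
          by_contra h
          exact hg ⟨hv1, hv2, h⟩
        obtain ⟨e, h1, -, h3⟩ := this
        refine Finset.mem_biUnion.mpr ⟨e, Finset.mem_filter.mpr ⟨Finset.mem_univ _, h1⟩, ?_⟩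
        exact Finset.mem_filter.mpr ⟨(memS v hv).1, (memS v hv).2, h3⟩
    have c1 := Finset.card_le_card hcov
    have c2 := Finset.card_union_le (S.filter (good p)) ({p.1, p.2} ∪
        P.biUnion fun e => A.filter fun v => SL2.tr v = t ∧ Fixes e v)
    have c3 := Finset.card_union_le ({p.1, p.2} : Finset SL(2, F))
        (P.biUnion fun e => A.filter fun v => SL2.tr v = t ∧ Fixes e v)
    have c4 : ({p.1, p.2} : Finset SL(2, F)).card ≤ 2 := Finset.card_le_two
    have c5 : (P.biUnion fun e => A.filter fun v => SL2.tr v = t ∧ Fixes e v).card ≤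
        P.card * (2 * m) :=
      Finset.card_biUnion_le_card_mul _ _ _ fun e _ => card_trace_fixes_le A e (hfix e) t
    have c6 : P.card * (2 * m) ≤ 3 * (2 * m) := Nat.mul_le_mul_right _ hP
    omega
  -- Above this threshold at least half of the third elements are good; below it the bound is
  -- immediate, with 4096 = 16³.
  by_cases hsmall : S.card ≤ 16 * m
  · calc S.card ^ 3 ≤ (16 * m) ^ 3 := Nat.pow_le_pow_left hsmall 3
      _ = 4096 * (m ^ 3 * 1) := by ring
      _ ≤ 4096 * (m ^ 3 * m) := by gcongr
      _ = 4096 * (m ^ 2) ^ 2 := by ring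
      _ ≤ 4096 * M ^ 2 := by gcongr
  push Not at hsmall
  let T : Finset (Σ _ : SL(2, F) × SL(2, F), SL(2, F)) := S.offDiag.sigma fun p => S.filter (good p)
  -- Triples with the same image differ by a common right factor y that keeps the three traces.
  -- Besides y = 1, `fixes_of_three_solutions` allows only one such y for a good triple, so fibres
  -- have at most two elements.
  let f : (Σ _ : SL(2, F) × SL(2, F), SL(2, F)) → SL(2, F) × SL(2, F) :=
    fun x => (x.1.2 * x.1.1⁻¹, x.2 * x.1.1⁻¹)
  have memT : ∀ x ∈ T, x.1.1 ∈ S ∧ x.1.2 ∈ S ∧ x.1.1 ≠ x.1.2 ∧ x.2 ∈ S ∧ good x.1 x.2 := by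
    intro x hx
    obtain ⟨hx1, hx2⟩ := Finset.mem_sigma.mp hx
    obtain ⟨h1, h2, h3⟩ := Finset.mem_offDiag.mp hx1
    obtain ⟨h4, h5⟩ := Finset.mem_filter.mp hx2
    exact ⟨h1, h2, h3, h4, h5⟩
  have hfT : ∀ x ∈ T, f x ∈ (A ^ 2) ×ˢ (A ^ 2) := by
    intro x hx
    obtain ⟨h1, h2, -, h4, -⟩ := memT x hx
    rw [pow_two]
    exact Finset.mk_mem_product
      (Finset.mul_mem_mul (memS _ h2).1 (hinv _ (memS _ h1).1))
      (Finset.mul_mem_mul (memS _ h4).1 (hinv _ (memS _ h1).1))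
  have hfib : ∀ b ∈ (A ^ 2) ×ˢ (A ^ 2), (T.filter fun x => f x = b).card ≤ 2 := by
    intro b _
    by_contra! hc
    obtain ⟨x, hx, y, hy, z, hz, hxy, hxz, hyz⟩ := Finset.two_lt_card.mp hc
    obtain ⟨hxT, fx⟩ := Finset.mem_filter.mp hx
    obtain ⟨hyT, fy⟩ := Finset.mem_filter.mp hy
    obtain ⟨hzT, fz⟩ := Finset.mem_filter.mp hz
    have rep : ∀ w w' : (Σ _ : SL(2, F) × SL(2, F), SL(2, F)), f w = f w' →
        w'.1.2 = w.1.2 * (w.1.1⁻¹ * w'.1.1) ∧ w'.2 = w.2 * (w.1.1⁻¹ * w'.1.1) := by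
      intro w w' h
      have e1 : w.1.2 * w.1.1⁻¹ = w'.1.2 * w'.1.1⁻¹ := congrArg Prod.fst h
      have e2 : w.2 * w.1.1⁻¹ = w'.2 * w'.1.1⁻¹ := congrArg Prod.snd h
      rw [← mul_assoc, ← mul_assoc, e1, e2]
      simp
    have inj : ∀ w w' : (Σ _ : SL(2, F) × SL(2, F), SL(2, F)), f w = f w' →
        w.1.1 = w'.1.1 → w = w' := by
      intro w w' h h'
      obtain ⟨r1, r2⟩ := rep w w' h
      rw [h'] at r1 r2
      simp at r1 r2
      obtain ⟨⟨a, b⟩, c⟩ := w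
      obtain ⟨⟨a', b'⟩, c'⟩ := w'
      simp only at r1 r2 h'
      rw [r1, r2, h']
    have fxy : f x = f y := by rw [fx, fy]
    have fxz : f x = f z := by rw [fx, fz]
    obtain ⟨y1, y2⟩ := rep x y fxy
    obtain ⟨z1, z2⟩ := rep x z fxz
    obtain ⟨s0, s1, sne, s2, g1, g2, g3⟩ := memT x hxT
    obtain ⟨sy0, sy1, -, sy2, -⟩ := memT y hyT
    obtain ⟨sz0, sz1, -, sz2, -⟩ := memT z hzT
    apply g3
    refine fixes_of_three_solutions ht (memS _ s0).2 (memS _ s1).2 (memS _ s2).2 sne g1.symm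
      g2.symm (y := x.1.1⁻¹ * y.1.1) (w := x.1.1⁻¹ * z.1.1) ?_ ?_ ?_ ?_ ?_ ?_ ?_ ?_ ?_
    · intro h
      exact hxy (inj x y fxy (inv_mul_eq_one.mp h))
    · intro h
      exact hxz (inj x z fxz (inv_mul_eq_one.mp h))
    · intro h
      exact hyz (inj y z (fy.trans fz.symm) (mul_left_cancel h))
    · rw [mul_inv_cancel_left]; exact (memS _ sy0).2
    · rw [← y1]; exact (memS _ sy1).2
    · rw [← y2]; exact (memS _ sy2).2
    · rw [mul_inv_cancel_left]; exact (memS _ sz0).2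
    · rw [← z1]; exact (memS _ sz1).2
    · rw [← z2]; exact (memS _ sz2).2
  have up : T.card ≤ 2 * (M * M) := by
    have h := Finset.card_le_mul_card_image_of_maps_to hfT 2 hfib
    rw [Finset.card_product] at h
    have hle : (A ^ 2).card ≤ M := Finset.card_le_card (Finset.pow_subset_pow_right h1 (by norm_num))
    calc T.card ≤ 2 * ((A ^ 2).card * (A ^ 2).card) := h
      _ ≤ 2 * (M * M) := by gcongr
  have low2 : S.offDiag.card * S.card ≤ 2 * T.card := by
    rw [Finset.card_sigma, ← smul_eq_mul, Finset.mul_sum]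
    apply Finset.card_nsmul_le_sum
    intro p hp
    have := hbad p hp
    omega
  have hoff : S.card * S.card ≤ 2 * S.offDiag.card := by
    rw [Finset.offDiag_card]
    have : 2 * S.card ≤ S.card * S.card := Nat.mul_le_mul_right _ (by omega)
    omega
  calc S.card ^ 3 = S.card * S.card * S.card := by ring
    _ ≤ 2 * S.offDiag.card * S.card := Nat.mul_le_mul_right _ hoff
    _ = 2 * (S.offDiag.card * S.card) := by ring
    _ ≤ 2 * (2 * (2 * (M * M))) := Nat.mul_le_mul_left _ (by omega)
    _ ≤ 4096 * M ^ 2 := by nlinarith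

end TraceBound

/-! ### The order of SL(2, F) -/

section Counting

variable {F : Type*} [Field F] [Fintype F] [DecidableEq F]

theorem card_SL2_le : Fintype.card SL(2, F) ≤ Fintype.card F ^ 3 := by
  have hinj : Function.Injective (fun m : SL(2, F) =>
      ((m.1 0 0, m.1 0 1, if m.1 0 0 = 0 then m.1 1 1 else m.1 1 0) : F × F × F)) := by
    intro m n h
    simp only [Prod.mk.injEq] at h
    obtain ⟨h0, h1, h2⟩ := h
    have dm := SL2.det_eq m
    have dn := SL2.det_eq n
    rw [← h0, ← h1] at dn
    rw [← h0] at h2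
    by_cases ha : m.1 0 0 = 0
    · rw [if_pos ha, if_pos ha] at h2
      rw [ha] at dm dn
      have hb : m.1 0 1 ≠ 0 := by intro hb; rw [hb] at dm; simp at dm
      refine SL2.ext h0 h1 ?_ h2
      apply mul_left_cancel₀ hb
      linear_combination dn - dm
    · rw [if_neg ha, if_neg ha] at h2
      refine SL2.ext h0 h1 h2 ?_
      rw [← h2] at dn
      apply mul_left_cancel₀ ha
      linear_combination dm - dn
  have := Fintype.card_le_of_injective _ hinj
  simp only [Fintype.card_prod] at this
  calc _ ≤ _ := this
    _ = _ := by ring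

theorem le_card_SL2 : (Fintype.card F - 1) * Fintype.card F ^ 2 ≤ Fintype.card SL(2, F) := by
  have hinj : Function.Injective (fun x : Fˣ × F × F =>
      (⟨!![(x.1 : F), x.2.1; x.2.2, (1 + x.2.1 * x.2.2) / x.1], by
        rw [Matrix.det_fin_two_of]; field_simp; ring⟩ : SL(2, F))) := by
    rintro ⟨a, b, c⟩ ⟨a', b', c'⟩ h
    have h0 := congrArg (fun m : SL(2, F) => m.1 0 0) h
    have h1 := congrArg (fun m : SL(2, F) => m.1 0 1) h
    have h2 := congrArg (fun m : SL(2, F) => m.1 1 0) h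
    simp at h0 h1 h2
    simp [Units.ext h0, h1, h2]
  have := Fintype.card_le_of_injective _ hinj
  simp only [Fintype.card_prod, Fintype.card_units] at this
  calc _ = _ := by ring
    _ ≤ _ := this

theorem card_pow_three_le_two_mul_card_SL2 :
    Fintype.card F ^ 3 ≤ 2 * Fintype.card SL(2, F) := by
  have h := le_card_SL2 (F := F)
  have h2 : 1 < Fintype.card F := Fintype.one_lt_card
  calc Fintype.card F ^ 3 = Fintype.card F * Fintype.card F ^ 2 := by ring
    _ ≤ 2 * (Fintype.card F - 1) * Fintype.card F ^ 2 := Nat.mul_le_mul_right _ (by omega)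
    _ = 2 * ((Fintype.card F - 1) * Fintype.card F ^ 2) := by ring
    _ ≤ _ := Nat.mul_le_mul_left _ h

end Counting

/-! ### Centralisers of regular elements -/

section Centralizer

variable {F : Type*} [Field F]

/-- An element with tr² ≠ 4 is not scalar, so its commutant among 2 × 2 matrices is spanned by 1 and
g. The coefficient β is read off from a nonzero off-diagonal entry, or from the difference of the
diagonal entries. -/
theorem commute_iff_exists {g : SL(2, F)} (hg : SL2.tr g ^ 2 ≠ 4) {z : SL(2, F)}
    (h : Commute z g) : ∃ α β : F, z.1 0 0 = α + β * g.1 0 0 ∧ z.1 0 1 = β * g.1 0 1 ∧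
      z.1 1 0 = β * g.1 1 0 ∧ z.1 1 1 = α + β * g.1 1 1 := by
  have h' : z * g = g * z := h
  have e00 := congrArg (fun m : SL(2, F) => m.1 0 0) h'
  have e01 := congrArg (fun m : SL(2, F) => m.1 0 1) h'
  have e10 := congrArg (fun m : SL(2, F) => m.1 1 0) h'
  simp only [SL2.mul_apply] at e00 e01 e10
  have key : ∀ β : F, z.1 0 1 = β * g.1 0 1 → z.1 1 0 = β * g.1 1 0 →
      z.1 1 1 - z.1 0 0 = β * (g.1 1 1 - g.1 0 0) → ∃ α β : F, z.1 0 0 = α + β * g.1 0 0 ∧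
      z.1 0 1 = β * g.1 0 1 ∧ z.1 1 0 = β * g.1 1 0 ∧ z.1 1 1 = α + β * g.1 1 1 :=
    fun β h1 h2 h3 => ⟨z.1 0 0 - β * g.1 0 0, β, by ring, h1, h2, by linear_combination h3⟩
  by_cases h01 : g.1 0 1 = 0
  · by_cases h10 : g.1 1 0 = 0
    · have hne : g.1 1 1 - g.1 0 0 ≠ 0 := by
        intro h0
        apply hg
        have hd := SL2.det_eq g
        have : g.1 1 1 = g.1 0 0 := by linear_combination h0
        rw [h01, this] at hd
        rw [SL2.tr, this]
        linear_combination 4 * hd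
      apply key ((z.1 1 1 - z.1 0 0) / (g.1 1 1 - g.1 0 0))
      · rw [h01] at e01 ⊢
        apply mul_left_cancel₀ hne
        linear_combination e01
      · rw [h10] at e10 ⊢
        apply mul_left_cancel₀ hne
        linear_combination -e10
      · field_simp
    · apply key (z.1 1 0 / g.1 1 0)
      · field_simp
        linear_combination e00
      · field_simp
      · field_simp
        linear_combination e10
  · apply key (z.1 0 1 / g.1 0 1)
    · field_simp
    · field_simp
      linear_combination -e00
    · field_simp
      linear_combination -e01

theorem Commute.of_regular {g y z : SL(2, F)} (hg : SL2.tr g ^ 2 ≠ 4) (hy : Commute y g)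
    (hz : Commute z g) : Commute y z := by
  obtain ⟨α, β, h1, h2, h3, h4⟩ := commute_iff_exists hg hy
  obtain ⟨γ, δ, k1, k2, k3, k4⟩ := commute_iff_exists hg hz
  apply SL2.ext <;> simp only [SL2.mul_apply, h1, h2, h3, h4, k1, k2, k3, k4] <;> ring

open Classical in
-- For z = α + βg of trace s, eliminating α from det z = 1 gives (4 - tr(g)²)β² + s² - 4 = 0, and β
-- determines α because 2 ≠ 0.
theorem card_commute_tr_le (h2 : (2 : F) ≠ 0) {g : SL(2, F)} (hg : SL2.tr g ^ 2 ≠ 4) (s : F)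
    (T : Finset SL(2, F)) (hT : ∀ z ∈ T, Commute z g ∧ SL2.tr z = s) : T.card ≤ 2 := by
  have : ∀ z : SL(2, F), ∃ β : F, z ∈ T → ∃ α : F, z.1 0 0 = α + β * g.1 0 0 ∧
      z.1 0 1 = β * g.1 0 1 ∧ z.1 1 0 = β * g.1 1 0 ∧ z.1 1 1 = α + β * g.1 1 1 := by
    intro z
    by_cases hz : z ∈ T
    · obtain ⟨α, β, h⟩ := commute_iff_exists hg (hT z hz).1
      exact ⟨β, fun _ => ⟨α, h⟩⟩
    · exact ⟨0, fun h => absurd h hz⟩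
  choose f hf using this
  have hinj : Set.InjOn f T := by
    intro z hz w hw hzw
    obtain ⟨α, a1, a2, a3, a4⟩ := hf z hz
    obtain ⟨γ, b1, b2, b3, b4⟩ := hf w hw
    have sz := (hT z hz).2
    have sw := (hT w hw).2
    rw [SL2.tr, a1, a4] at sz
    rw [SL2.tr, b1, b4] at sw
    rw [← hzw] at b1 b2 b3 b4 sw
    have : α = γ := by
      apply mul_left_cancel₀ h2
      linear_combination sz - sw
    exact SL2.ext (by rw [a1, b1, this]) (by rw [a2, b2]) (by rw [a3, b3]) (by rw [a4, b4, this])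
  rw [← Finset.card_image_of_injOn hinj]
  apply card_le_two_of_quadratic _ (4 - SL2.tr g ^ 2) 0 (s ^ 2 - 4)
  · rintro ⟨h, -, -⟩
    exact hg (by linear_combination -h)
  · intro x hx
    obtain ⟨z, hz, rfl⟩ := Finset.mem_image.mp hx
    obtain ⟨α, a1, a2, a3, a4⟩ := hf z hz
    have sz := (hT z hz).2
    have hd := SL2.det_eq z
    have hdg := SL2.det_eq g
    rw [SL2.tr, a1, a4] at sz
    rw [a1, a2, a3, a4] at hd
    rw [SL2.tr]
    linear_combination 4 * hd - 4 * f z ^ 2 * hdg -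
      (s + 2 * α + f z * (g.1 0 0 + g.1 1 1)) * sz

open Classical in
theorem card_commute_le [Fintype F] {g : SL(2, F)} (hg : SL2.tr g ^ 2 ≠ 4)
    (T : Finset SL(2, F)) (hT : ∀ z ∈ T, Commute z g) : T.card ≤ 2 * Fintype.card F := by
  have : ∀ z : SL(2, F), ∃ β α : F, z ∈ T → z.1 0 0 = α + β * g.1 0 0 ∧
      z.1 0 1 = β * g.1 0 1 ∧ z.1 1 0 = β * g.1 1 0 ∧ z.1 1 1 = α + β * g.1 1 1 := by
    intro z
    by_cases hz : z ∈ T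
    · obtain ⟨α, β, h⟩ := commute_iff_exists hg (hT z hz)
      exact ⟨β, α, fun _ => h⟩
    · exact ⟨0, 0, fun h => absurd h hz⟩
  choose f a hf using this
  have := Finset.card_le_mul_card_image_of_maps_to (s := T) (t := Finset.univ) (f := f)
    (fun _ _ => Finset.mem_univ _) 2 ?_
  · simpa using this
  intro b _
  set Q := T.filter fun z => f z = b with hQ
  have mem : ∀ z ∈ Q, z.1 0 0 = a z + b * g.1 0 0 ∧
      z.1 0 1 = b * g.1 0 1 ∧ z.1 1 0 = b * g.1 1 0 ∧ z.1 1 1 = a z + b * g.1 1 1 := by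
    intro z hz
    obtain ⟨h1, h2⟩ := Finset.mem_filter.mp hz
    have := hf z h1
    rwa [h2] at this
  have hinj : Set.InjOn a Q := by
    intro z hz w hw hzw
    obtain ⟨a1, a2, a3, a4⟩ := mem z hz
    obtain ⟨b1, b2, b3, b4⟩ := mem w hw
    exact SL2.ext (by rw [a1, b1, hzw]) (by rw [a2, b2]) (by rw [a3, b3]) (by rw [a4, b4, hzw])
  rw [← Finset.card_image_of_injOn hinj]
  apply card_le_two_of_quadratic _ 1 (b * SL2.tr g) (b ^ 2 - 1) (by simp)
  intro x hx
  obtain ⟨z, hz, rfl⟩ := Finset.mem_image.mp hx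
  obtain ⟨a1, a2, a3, a4⟩ := mem z hz
  have hd := SL2.det_eq z
  have hdg := SL2.det_eq g
  rw [a1, a2, a3, a4] at hd
  rw [SL2.tr]
  linear_combination hd - b ^ 2 * hdg

end Centralizer

/-! ### Centralisers inside powers of a symmetric set -/

section Growth

open scoped Pointwise

variable {F : Type*} [Field F]

open Classical in
/-- The elements of `B` that commute with `g`. -/
noncomputable def centIn (B : Finset SL(2, F)) (g : SL(2, F)) : Finset SL(2, F) :=
  B.filter fun z => Commute z g

theorem mem_centIn {B : Finset SL(2, F)} {g z : SL(2, F)} :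
    z ∈ centIn B g ↔ z ∈ B ∧ Commute z g := by
  classical
  exact Finset.mem_filter

variable [DecidableEq F] {A : Finset SL(2, F)}

theorem inv_mem_pow (hinv : ∀ a ∈ A, a⁻¹ ∈ A) (n : ℕ) : ∀ a ∈ A ^ n, a⁻¹ ∈ A ^ n := by
  intro a ha
  have hA : A⁻¹ = A := by
    ext x
    rw [Finset.mem_inv']
    exact ⟨fun h => by simpa using hinv _ h, fun h => hinv _ h⟩
  have : a⁻¹ ∈ (A ^ n)⁻¹ := Finset.inv_mem_inv ha
  rwa [← inv_pow, hA] at this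

/-- Orbit counting for a ↦ a * y * a⁻¹: a fibre is carried into the centraliser of y by left
multiplication by a₀⁻¹, and the image lies in one trace fibre of A⁴. -/
theorem card_le_centIn_mul (hinv : ∀ a ∈ A, a⁻¹ ∈ A) {y : SL(2, F)}
    (hy : y ∈ A ^ 2) :
    A.card ≤ (centIn (A ^ 2) y).card * ((A ^ 4).filter fun v => SL2.tr v = SL2.tr y).card := by
  apply Finset.card_le_mul_card_image_of_maps_to (f := fun a => a * y * a⁻¹)
  · intro a ha
    refine Finset.mem_filter.mpr ⟨?_, SL2.tr_conj a y⟩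
    have : A ^ 4 = A * A ^ 2 * A := by rw [← pow_succ', ← pow_succ]
    rw [this]
    exact Finset.mul_mem_mul (Finset.mul_mem_mul ha hy) (hinv a ha)
  · intro b _
    rcases Finset.eq_empty_or_nonempty (A.filter fun a => a * y * a⁻¹ = b) with h | ⟨a₀, h₀⟩
    · rw [h]; simp
    obtain ⟨m₀, e₀⟩ := Finset.mem_filter.mp h₀
    apply Finset.card_le_card_of_injOn (fun a => a₀⁻¹ * a)
    · intro a ha
      obtain ⟨m, e⟩ := Finset.mem_filter.mp (Finset.mem_coe.mp ha)
      refine Finset.mem_coe.mpr (mem_centIn.mpr ⟨?_, ?_⟩)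
      · rw [pow_two]; exact Finset.mul_mem_mul (hinv _ m₀) m
      · have h : a * y * a⁻¹ = a₀ * y * a₀⁻¹ := e.trans e₀.symm
        have h' : a * y = a₀ * y * a₀⁻¹ * a := by rw [← h]; group
        change a₀⁻¹ * a * y = y * (a₀⁻¹ * a)
        rw [mul_assoc, h']; group
    · intro a _ b _ h
      exact mul_left_cancel h

/-- Multiplication A × C(g) → A⁵ has fibres that embed in A² ∩ C(g). Hence A⁵ is large when a torus
is rich in A⁴ but poor in A². -/
theorem card_mul_centIn_le (hinv : ∀ a ∈ A, a⁻¹ ∈ A) (g : SL(2, F)) :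
    A.card * (centIn (A ^ 4) g).card ≤ (centIn (A ^ 2) g).card * (A ^ 5).card := by
  rw [← Finset.card_product]
  apply Finset.card_le_mul_card_image_of_maps_to (f := fun p => p.1 * p.2)
  · intro p hp
    obtain ⟨h1, h2⟩ := Finset.mem_product.mp hp
    have : A ^ 5 = A * A ^ 4 := by rw [← pow_succ']
    rw [this]
    exact Finset.mul_mem_mul h1 (mem_centIn.mp h2).1
  · intro b _
    rcases Finset.eq_empty_or_nonempty
      ((A ×ˢ centIn (A ^ 4) g).filter fun p => p.1 * p.2 = b) with h | ⟨p₀, h₀⟩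
    · rw [h]; simp
    obtain ⟨m₀, e₀⟩ := Finset.mem_filter.mp h₀
    obtain ⟨m₁, m₂⟩ := Finset.mem_product.mp m₀
    apply Finset.card_le_card_of_injOn (fun p => p₀.1⁻¹ * p.1)
    · intro p hp
      obtain ⟨m, e⟩ := Finset.mem_filter.mp (Finset.mem_coe.mp hp)
      obtain ⟨n₁, n₂⟩ := Finset.mem_product.mp m
      refine Finset.mem_coe.mpr (mem_centIn.mpr ⟨?_, ?_⟩)
      · rw [pow_two]; exact Finset.mul_mem_mul (hinv _ m₁) n₁
      · have h : p.1 * p.2 = p₀.1 * p₀.2 := e.trans e₀.symm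
        have h' : p₀.1⁻¹ * p.1 = p₀.2 * p.2⁻¹ := by
          rw [eq_mul_inv_iff_mul_eq, mul_assoc, h]; group
        simp only
        rw [h']
        exact (mem_centIn.mp m₂).2.mul_left (mem_centIn.mp n₂).2.inv_left
    · intro p hp p' hp' h
      obtain ⟨-, e⟩ := Finset.mem_filter.mp (Finset.mem_coe.mp hp)
      obtain ⟨-, e'⟩ := Finset.mem_filter.mp (Finset.mem_coe.mp hp')
      have h1 : p.1 = p'.1 := mul_left_cancel h
      have h2 : p.2 = p'.2 := by
        have := e.trans e'.symm
        rw [h1] at this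
        exact mul_left_cancel this
      exact Prod.ext h1 h2

theorem card_centIn_le_conj (hinv : ∀ a ∈ A, a⁻¹ ∈ A) {a : SL(2, F)} (ha : a ∈ A)
    (g : SL(2, F)) : (centIn (A ^ 2) g).card ≤ (centIn (A ^ 4) (a * g * a⁻¹)).card := by
  apply Finset.card_le_card_of_injOn (fun z => a * z * a⁻¹)
  · intro z hz
    obtain ⟨h1, h2⟩ := mem_centIn.mp (Finset.mem_coe.mp hz)
    refine Finset.mem_coe.mpr (mem_centIn.mpr ⟨?_, ?_⟩)
    · have : A ^ 4 = A * A ^ 2 * A := by rw [← pow_succ', ← pow_succ]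
      rw [this]
      exact Finset.mul_mem_mul (Finset.mul_mem_mul ha h1) (hinv a ha)
    · have h2' : z * g = g * z := h2
      change a * z * a⁻¹ * (a * g * a⁻¹) = a * g * a⁻¹ * (a * z * a⁻¹)
      calc _ = a * (z * g) * a⁻¹ := by group
        _ = a * (g * z) * a⁻¹ := by rw [h2']
        _ = _ := by group
  · intro z _ w _ h
    exact mul_left_cancel (mul_right_cancel h)

/-- Orbit counting is combined with the trace bound for A⁴, at a regular y of nonzero trace having
the same centraliser as g. Seven commuting elements ensure that such a y exists, since the traces 0,
2 and -2 account for at most six. -/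
theorem card_pow_three_le_centIn [Fintype F] (h2 : (2 : F) ≠ 0) (h1 : 1 ∈ A)
    (hinv : ∀ a ∈ A, a⁻¹ ∈ A) (hfix : ∀ e, ∃ a ∈ A, ¬ Fixes e a) {g : SL(2, F)}
    (hg : SL2.tr g ^ 2 ≠ 4) (hc : (g ∈ A ^ 2 ∧ SL2.tr g ≠ 0) ∨ 7 ≤ (centIn (A ^ 2) g).card) :
    A.card ^ 3 ≤ 4096 * (centIn (A ^ 2) g).card ^ 3 * (A ^ 12).card ^ 2 := by
  classical
  obtain ⟨y, hy, hy0, hy4⟩ : ∃ y ∈ centIn (A ^ 2) g, SL2.tr y ≠ 0 ∧ SL2.tr y ^ 2 ≠ 4 := by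
    rcases hc with ⟨hc1, hc2⟩ | hc
    · exact ⟨g, mem_centIn.mpr ⟨hc1, Commute.refl g⟩, hc2, hg⟩
    by_contra! hcon
    have hcov : centIn (A ^ 2) g ⊆ (centIn (A ^ 2) g).filter (fun z => SL2.tr z = 0) ∪
        ((centIn (A ^ 2) g).filter (fun z => SL2.tr z = 2) ∪
          (centIn (A ^ 2) g).filter (fun z => SL2.tr z = -2)) := by
      intro z hz
      simp only [Finset.mem_union, Finset.mem_filter, hz, true_and]
      by_cases h0 : SL2.tr z = 0
      · exact Or.inl h0
      · right
        have := hcon z hz h0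
        have : (SL2.tr z - 2) * (SL2.tr z + 2) = 0 := by linear_combination this
        rcases mul_eq_zero.mp this with h | h
        · exact Or.inl (by linear_combination h)
        · exact Or.inr (by linear_combination h)
    have hb : ∀ s : F, ((centIn (A ^ 2) g).filter (fun z => SL2.tr z = s)).card ≤ 2 := fun s =>
      card_commute_tr_le h2 hg s _ fun z hz =>
        ⟨(mem_centIn.mp (Finset.mem_filter.mp hz).1).2, (Finset.mem_filter.mp hz).2⟩
    have c1 := Finset.card_le_card hcov
    have c2 := Finset.card_union_le ((centIn (A ^ 2) g).filter (fun z => SL2.tr z = 0))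
        ((centIn (A ^ 2) g).filter (fun z => SL2.tr z = 2) ∪
          (centIn (A ^ 2) g).filter (fun z => SL2.tr z = -2))
    have c3 := Finset.card_union_le ((centIn (A ^ 2) g).filter (fun z => SL2.tr z = 2))
          ((centIn (A ^ 2) g).filter (fun z => SL2.tr z = -2))
    have := hb 0
    have := hb 2
    have := hb (-2)
    omega
  obtain ⟨hyA, hyg⟩ := mem_centIn.mp hy
  have hcent : centIn (A ^ 2) y = centIn (A ^ 2) g := by
    ext z
    rw [mem_centIn, mem_centIn]
    constructor
    · rintro ⟨h, h'⟩
      exact ⟨h, Commute.of_regular hy4 h' hyg.symm⟩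
    · rintro ⟨h, h'⟩
      exact ⟨h, Commute.of_regular hg h' hyg⟩
  have k1 := card_le_centIn_mul hinv hyA
  rw [hcent] at k1
  have hA4 : (A : Finset SL(2, F)) ⊆ A ^ 4 := by
    calc A = A ^ 1 := (pow_one A).symm
      _ ⊆ A ^ 4 := Finset.pow_subset_pow_right h1 (by norm_num)
  have k2 := card_trace_pow_three_le (A ^ 4) (hA4 h1) (inv_mem_pow hinv 4)
    (fun e => let ⟨a, ha, hae⟩ := hfix e; ⟨a, hA4 ha, hae⟩) hy0 hy4
  rw [← pow_mul] at k2
  calc A.card ^ 3 ≤ ((centIn (A ^ 2) g).card *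
          ((A ^ 4).filter fun v => SL2.tr v = SL2.tr y).card) ^ 3 := Nat.pow_le_pow_left k1 3
    _ = (centIn (A ^ 2) g).card ^ 3 *
          ((A ^ 4).filter fun v => SL2.tr v = SL2.tr y).card ^ 3 := by ring
    _ ≤ (centIn (A ^ 2) g).card ^ 3 * (4096 * (A ^ 12).card ^ 2) := Nat.mul_le_mul_left _ k2
    _ = _ := by ring

end Growth

/-! ### The pivoting argument and the growth theorem -/

section Growth

open scoped Pointwise

variable {F : Type*} [Field F] [DecidableEq F] [Fintype F] {A : Finset SL(2, F)}

/-- Richness of a torus propagates along words in A. If it failed after conjugation by some y in A,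
the lower bound for A² ∩ C(g') and the upper bound from `card_mul_centIn_le` would contradict
`hgrow`; the constant is 4096 · 6³ ≤ 2²⁰. -/
theorem seven_le_card_centIn (h2 : (2 : F) ≠ 0) (h1 : 1 ∈ A)
    (hinv : ∀ a ∈ A, a⁻¹ ∈ A) (hfix : ∀ e, ∃ a ∈ A, ¬ Fixes e a)
    (hgrow : 2 ^ 20 * (A ^ 12).card ^ 5 < A.card ^ 6) {g : SL(2, F)} (hgA : g ∈ A)
    (hg0 : SL2.tr g ≠ 0) (hg : SL2.tr g ^ 2 ≠ 4) {x : SL(2, F)}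
    (hx : x ∈ Subgroup.closure (A : Set SL(2, F))) :
    7 ≤ (centIn (A ^ 2) (x * g * x⁻¹)).card := by
  have hmono : ∀ k ≤ 12, (A ^ k).card ≤ (A ^ 12).card := fun k hk =>
    Finset.card_le_card (Finset.pow_subset_pow_right h1 hk)
  have hA : A.card ≤ (A ^ 12).card := by simpa using hmono 1 (by norm_num)
  have step : ∀ y ∈ A, ∀ g' : SL(2, F), SL2.tr g' ^ 2 ≠ 4 → 7 ≤ (centIn (A ^ 2) g').card →
      7 ≤ (centIn (A ^ 2) (y * g' * y⁻¹)).card := by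
    intro y hy g' hg' h7
    by_contra! hlt
    have k1 := card_pow_three_le_centIn h2 h1 hinv hfix hg' (Or.inr h7)
    have k2 := card_centIn_le_conj hinv hy g'
    have k3 := card_mul_centIn_le hinv (y * g' * y⁻¹)
    have k4 : A.card * (centIn (A ^ 2) g').card ≤ 6 * (A ^ 12).card :=
      calc _ ≤ A.card * (centIn (A ^ 4) (y * g' * y⁻¹)).card := Nat.mul_le_mul_left _ k2
        _ ≤ _ := k3
        _ ≤ 6 * (A ^ 12).card := Nat.mul_le_mul (by omega) (hmono 5 (by norm_num))
    have : A.card ^ 6 ≤ 2 ^ 20 * (A ^ 12).card ^ 5 :=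
      calc A.card ^ 6 = A.card ^ 3 * A.card ^ 3 := by ring
        _ ≤ A.card ^ 3 * (4096 * (centIn (A ^ 2) g').card ^ 3 * (A ^ 12).card ^ 2) :=
          Nat.mul_le_mul_left _ k1
        _ = 4096 * (A.card * (centIn (A ^ 2) g').card) ^ 3 * (A ^ 12).card ^ 2 := by ring
        _ ≤ 4096 * (6 * (A ^ 12).card) ^ 3 * (A ^ 12).card ^ 2 := by gcongr
        _ = 884736 * (A ^ 12).card ^ 5 := by ring
        _ ≤ 2 ^ 20 * (A ^ 12).card ^ 5 := Nat.mul_le_mul_right _ (by norm_num)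
    omega
  induction hx using Subgroup.closure_induction_left with
  | one =>
    rw [one_mul, inv_one, mul_one]
    by_contra! hlt
    have hgA2 : g ∈ A ^ 2 := by
      have := Finset.pow_subset_pow_right h1 (show 1 ≤ 2 by norm_num)
      rw [pow_one] at this
      exact this hgA
    have k1 := card_pow_three_le_centIn h2 h1 hinv hfix hg (Or.inl ⟨hgA2, hg0⟩)
    have : A.card ^ 6 ≤ 2 ^ 20 * (A ^ 12).card ^ 5 :=
      calc A.card ^ 6 = A.card ^ 3 * A.card ^ 3 := by ring
        _ ≤ (A ^ 12).card ^ 3 * (4096 * (centIn (A ^ 2) g).card ^ 3 * (A ^ 12).card ^ 2) := by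
          gcongr
        _ ≤ (A ^ 12).card ^ 3 * (4096 * 6 ^ 3 * (A ^ 12).card ^ 2) := by gcongr; omega
        _ = 884736 * (A ^ 12).card ^ 5 := by ring
        _ ≤ 2 ^ 20 * (A ^ 12).card ^ 5 := Nat.mul_le_mul_right _ (by norm_num)
    omega
  | mul_left y hy z _ ih =>
    have := step y hy (z * g * z⁻¹) (by rwa [SL2.tr_conj]) ih
    convert this using 3
    group
  | inv_mul_cancel y hy z _ ih =>
    have := step y⁻¹ (hinv y hy) (z * g * z⁻¹) (by rwa [SL2.tr_conj]) ih
    convert this using 3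
    group

/-- Growth in `SL(2, F)`: a symmetric generating set either grows by a fixed power under taking
twelvefold products or is already large. -/
theorem card_growth (h2 : (2 : F) ≠ 0) (h1 : 1 ∈ A)
    (hinv : ∀ a ∈ A, a⁻¹ ∈ A) (hfix : ∀ e, ∃ a ∈ A, ¬ Fixes e a)
    (hgen : Subgroup.closure (A : Set SL(2, F)) = ⊤) {g : SL(2, F)} (hgA : g ∈ A)
    (hg0 : SL2.tr g ≠ 0) (hg : SL2.tr g ^ 2 ≠ 4) :
    A.card ^ 6 ≤ 2 ^ 26 * (A ^ 12).card ^ 5 ∨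
      Fintype.card F ^ 6 * A.card ^ 3 ≤ 2 ^ 26 * (A ^ 12).card ^ 5 := by
  classical
  rw [or_iff_not_imp_left]
  intro hgrow
  push Not at hgrow
  have hgrow' : 2 ^ 20 * (A ^ 12).card ^ 5 < A.card ^ 6 :=
    lt_of_le_of_lt (Nat.mul_le_mul_right _ (by norm_num)) hgrow
  let Cl : Finset SL(2, F) := Finset.univ.image fun x => x * g * x⁻¹
  let c : SL(2, F) → ℕ := fun g' =>
    ((centIn (A ^ 2) g').filter fun y => SL2.tr y ^ 2 ≠ 4).card
  have hClne : Cl.Nonempty := Finset.image_nonempty.mpr ⟨1, Finset.mem_univ _⟩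
  -- A lower bound at the minimiser holds on the whole conjugacy class.
  obtain ⟨g₁, hg₁, hmin⟩ := Finset.exists_min_image Cl c hClne
  have htr : ∀ g' ∈ Cl, SL2.tr g' = SL2.tr g := by
    intro g' h
    obtain ⟨x, -, rfl⟩ := Finset.mem_image.mp h
    exact SL2.tr_conj x g
  have hcl : Fintype.card SL(2, F) ≤ 2 * Fintype.card F * Cl.card := by
    have := Finset.card_le_mul_card_image (f := fun x : SL(2, F) => x * g * x⁻¹)
      Finset.univ (2 * Fintype.card F) ?_
    · rwa [Finset.card_univ] at this
    intro b hb
    obtain ⟨x₀, -, h₀⟩ := Finset.mem_image.mp hb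
    rw [← Finset.card_image_of_injective _ (mul_right_injective x₀⁻¹)]
    apply card_commute_le hg
    intro z hz
    obtain ⟨x, hx, rfl⟩ := Finset.mem_image.mp hz
    have h : x * g * x⁻¹ = x₀ * g * x₀⁻¹ := (Finset.mem_filter.mp hx).2.trans h₀.symm
    have h' : x * g = x₀ * g * x₀⁻¹ * x := by rw [← h]; group
    change x₀⁻¹ * x * g = g * (x₀⁻¹ * x)
    rw [mul_assoc, h']; group
  have hb : A.card ^ 3 ≤ 4096 * 27 * c g₁ ^ 3 * (A ^ 12).card ^ 2 := by
    obtain ⟨x, -, hx⟩ := Finset.mem_image.mp hg₁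
    have h7 : 7 ≤ (centIn (A ^ 2) g₁).card := by
      rw [← hx]
      exact seven_le_card_centIn h2 h1 hinv hfix hgrow' hgA hg0 hg (by rw [hgen]; trivial)
    have hg₁4 : SL2.tr g₁ ^ 2 ≠ 4 := by rw [htr _ hg₁]; exact hg
    have k1 := card_pow_three_le_centIn h2 h1 hinv hfix hg₁4 (Or.inr h7)
    -- At most four of at least seven elements have trace ±2, so at least a third are regular.
    have k2 : (centIn (A ^ 2) g₁).card ≤ 3 * c g₁ := by
      have hcov : centIn (A ^ 2) g₁ ⊆ ((centIn (A ^ 2) g₁).filter fun y => SL2.tr y ^ 2 ≠ 4) ∪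
          ((centIn (A ^ 2) g₁).filter (fun z => SL2.tr z = 2) ∪
            (centIn (A ^ 2) g₁).filter (fun z => SL2.tr z = -2)) := by
        intro z hz
        simp only [Finset.mem_union, Finset.mem_filter, hz, true_and]
        by_cases h0 : SL2.tr z ^ 2 = 4
        · right
          have : (SL2.tr z - 2) * (SL2.tr z + 2) = 0 := by linear_combination h0
          rcases mul_eq_zero.mp this with h | h
          · exact Or.inl (by linear_combination h)
          · exact Or.inr (by linear_combination h)
        · exact Or.inl h0
      have hb : ∀ s : F, ((centIn (A ^ 2) g₁).filter (fun z => SL2.tr z = s)).card ≤ 2 := fun s =>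
        card_commute_tr_le h2 hg₁4 s _ fun z hz =>
          ⟨(mem_centIn.mp (Finset.mem_filter.mp hz).1).2, (Finset.mem_filter.mp hz).2⟩
      have c1 := Finset.card_le_card hcov
      have c2 := Finset.card_union_le ((centIn (A ^ 2) g₁).filter fun y => SL2.tr y ^ 2 ≠ 4)
        ((centIn (A ^ 2) g₁).filter (fun z => SL2.tr z = 2) ∪
            (centIn (A ^ 2) g₁).filter (fun z => SL2.tr z = -2))
      have c3 := Finset.card_union_le ((centIn (A ^ 2) g₁).filter (fun z => SL2.tr z = 2))
            ((centIn (A ^ 2) g₁).filter (fun z => SL2.tr z = -2))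
      have := hb 2
      have := hb (-2)
      simp only [c]
      omega
    calc A.card ^ 3 ≤ _ := k1
      _ ≤ 4096 * (3 * c g₁) ^ 3 * (A ^ 12).card ^ 2 := by gcongr
      _ = _ := by ring
  -- Double counting of pairs (g', y) with y regular in A² ∩ C(g'): a given y commutes with at most
  -- two elements of trace tr g.
  have hcount : Cl.card * c g₁ ≤ 2 * (A ^ 12).card := by
    let T : Finset (Σ _ : SL(2, F), SL(2, F)) :=
      Cl.sigma fun g' => (centIn (A ^ 2) g').filter fun y => SL2.tr y ^ 2 ≠ 4
    have t1 : Cl.card * c g₁ ≤ T.card := by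
      rw [Finset.card_sigma, ← smul_eq_mul]
      exact Finset.card_nsmul_le_sum _ _ _ hmin
    have t2 : T.card ≤ 2 * (A ^ 2).card := by
      apply Finset.card_le_mul_card_image_of_maps_to (f := fun x => x.2)
      · intro x hx
        exact (mem_centIn.mp (Finset.mem_filter.mp (Finset.mem_sigma.mp hx).2).1).1
      · intro y _
        rcases Finset.eq_empty_or_nonempty (T.filter fun x => x.2 = y) with h | ⟨x₀, h₀⟩
        · rw [h]; simp
        have hy4 : SL2.tr y ^ 2 ≠ 4 := by
          obtain ⟨h3, h4⟩ := Finset.mem_filter.mp h₀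
          rw [← h4]
          exact (Finset.mem_filter.mp (Finset.mem_sigma.mp h3).2).2
        have hinj : Set.InjOn (fun x : (Σ _ : SL(2, F), SL(2, F)) => x.1)
            (T.filter fun x => x.2 = y) := by
          rintro ⟨a, b⟩ h ⟨a', b'⟩ h' haa
          have e1 := (Finset.mem_filter.mp (Finset.mem_coe.mp h)).2
          have e2 := (Finset.mem_filter.mp (Finset.mem_coe.mp h')).2
          simp only at e1 e2 haa
          rw [e1, e2, haa]
        rw [← Finset.card_image_of_injOn hinj]
        apply card_commute_tr_le h2 hy4 (SL2.tr g)
        intro z hz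
        obtain ⟨x, hx, rfl⟩ := Finset.mem_image.mp hz
        obtain ⟨h3, h4⟩ := Finset.mem_filter.mp hx
        obtain ⟨h5, h6⟩ := Finset.mem_sigma.mp h3
        have h7 := (mem_centIn.mp (Finset.mem_filter.mp h6).1).2
        rw [h4] at h7
        exact ⟨h7.symm, htr _ h5⟩
    have t3 : (A ^ 2).card ≤ (A ^ 12).card :=
      Finset.card_le_card (Finset.pow_subset_pow_right h1 (by norm_num))
    omega
  have hG := card_pow_three_le_two_mul_card_SL2 (F := F)
  have hq : 0 < Fintype.card F := Fintype.card_pos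
  have hq2 : Fintype.card F ^ 2 ≤ 4 * Cl.card := by
    apply Nat.le_of_mul_le_mul_left _ hq
    calc Fintype.card F * Fintype.card F ^ 2 = Fintype.card F ^ 3 := by ring
      _ ≤ 2 * (2 * Fintype.card F * Cl.card) := hG.trans (Nat.mul_le_mul_left _ hcl)
      _ = _ := by ring
  calc Fintype.card F ^ 6 * A.card ^ 3 = (Fintype.card F ^ 2) ^ 3 * A.card ^ 3 := by ring
    _ ≤ (4 * Cl.card) ^ 3 * (4096 * 27 * c g₁ ^ 3 * (A ^ 12).card ^ 2) := by gcongr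
    _ = 64 * 4096 * 27 * (Cl.card * c g₁) ^ 3 * (A ^ 12).card ^ 2 := by ring
    _ ≤ 64 * 4096 * 27 * (2 * (A ^ 12).card) ^ 3 * (A ^ 12).card ^ 2 := by gcongr
    _ = 56623104 * (A ^ 12).card ^ 5 := by ring
    _ ≤ 2 ^ 26 * (A ^ 12).card ^ 5 := Nat.mul_le_mul_right _ (by norm_num)

end Growth

/-! ### A point-line incidence bound -/

section Incidence

variable {F : Type*} [Field F] [Fintype F] [DecidableEq F]

/-- A point-line incidence bound in the plane over a finite field, in qualitative form. -/
theorem exists_mul_add_eq (X Y U S : Finset F)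
    (h : Fintype.card F ^ 3 < X.card * S.card * (Y.card * U.card)) :
    ∃ x ∈ X, ∃ y ∈ Y, ∃ u ∈ U, ∃ s ∈ S, x * y + u = s := by
  by_contra! hno
  set P := Y ×ˢ U with hP
  obtain ⟨q, hqF⟩ : ∃ q : ℤ, q = Fintype.card F := ⟨_, rfl⟩
  let f : F × F → ℤ := fun l => ∑ p ∈ P, if l.1 * p.1 + p.2 = l.2 then 1 else 0
  have hf1 : ∑ l, f l = q * P.card := by
    rw [Finset.sum_comm]
    have : ∀ p ∈ P, (∑ l : F × F, if l.1 * p.1 + p.2 = l.2 then (1 : ℤ) else 0) = q := by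
      intro p _
      rw [Fintype.sum_prod_type]
      simp [hqF]
    rw [Finset.sum_congr rfl this]
    simp [mul_comm]
  have hf2 : ∑ l, f l ^ 2 ≤ q * P.card + P.card * P.card := by
    have e1 : ∀ l, f l ^ 2 = ∑ p ∈ P, ∑ p' ∈ P,
        if l.1 * p.1 + p.2 = l.2 ∧ l.1 * p'.1 + p'.2 = l.2 then (1 : ℤ) else 0 := by
      intro l
      rw [pow_two, Finset.sum_mul_sum]
      refine Finset.sum_congr rfl fun p _ => Finset.sum_congr rfl fun p' _ => ?_
      by_cases h1 : l.1 * p.1 + p.2 = l.2 <;> by_cases h2 : l.1 * p'.1 + p'.2 = l.2 <;>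
        simp [h1, h2]
    have e2 : ∀ p ∈ P, ∀ p' ∈ P, (∑ l : F × F,
        if l.1 * p.1 + p.2 = l.2 ∧ l.1 * p'.1 + p'.2 = l.2 then (1 : ℤ) else 0) ≤
          (if p = p' then q else 0) + 1 := by
      intro p _ p' _
      rw [Fintype.sum_prod_type]
      have e3 : ∀ x : F, (∑ s : F, if x * p.1 + p.2 = s ∧ x * p'.1 + p'.2 = s then (1 : ℤ) else 0)
          = if x * p.1 + p.2 = x * p'.1 + p'.2 then 1 else 0 := by
        intro x
        by_cases hx : x * p.1 + p.2 = x * p'.1 + p'.2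
        · simp [hx]
        · rw [if_neg hx]
          apply Finset.sum_eq_zero
          intro s _
          rw [if_neg]
          rintro ⟨h1, h2⟩
          exact hx (h1.trans h2.symm)
      simp only [e3]
      rw [Finset.sum_boole]
      by_cases hpp : p = p'
      · rw [if_pos hpp]
        have : ((Finset.univ.filter fun x : F => x * p.1 + p.2 = x * p'.1 + p'.2).card : ℤ) ≤ q := by
          rw [hqF]; exact_mod_cast Finset.card_le_univ _
        omega
      · rw [if_neg hpp, zero_add]
        have : (Finset.univ.filter fun x : F => x * p.1 + p.2 = x * p'.1 + p'.2).card ≤ 1 := by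
          rw [Finset.card_le_one]
          intro x hx y hy
          have hx' := (Finset.mem_filter.mp hx).2
          have hy' := (Finset.mem_filter.mp hy).2
          have hne : p.1 - p'.1 ≠ 0 := by
            intro h0
            have h0' := sub_eq_zero.mp h0
            rw [h0'] at hx'
            exact hpp (Prod.ext h0' (add_left_cancel hx'))
          apply mul_right_cancel₀ hne
          linear_combination hx' - hy'
        exact_mod_cast this
    calc ∑ l, f l ^ 2 = ∑ p ∈ P, ∑ p' ∈ P, ∑ l : F × F,
          if l.1 * p.1 + p.2 = l.2 ∧ l.1 * p'.1 + p'.2 = l.2 then (1 : ℤ) else 0 := by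
          simp only [e1]
          rw [Finset.sum_comm]
          exact Finset.sum_congr rfl fun p _ => Finset.sum_comm
      _ ≤ ∑ p ∈ P, ∑ p' ∈ P, ((if p = p' then q else 0) + 1) :=
          Finset.sum_le_sum fun p hp => Finset.sum_le_sum fun p' hp' => e2 p hp p' hp'
      _ = q * P.card + P.card * P.card := by
          have : ∀ p ∈ P, (∑ p' ∈ P, ((if p = p' then q else 0) + 1)) = q + P.card := by
            intro p hp
            simp [Finset.sum_add_distrib, hp]
          rw [Finset.sum_congr rfl this]
          simp
          ring
  have hq : 0 < q := by rw [hqF]; exact_mod_cast Fintype.card_pos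
  have hcardl : ((Finset.univ : Finset (F × F)).card : ℤ) = q ^ 2 := by
    simp [hqF, pow_two]
  -- `f` counts the points of P on a line and has mean |P|/q. Two distinct points share at most one
  -- line, which bounds the second moment and hence this variance.
  have hvar : ∑ l, (q * f l - P.card) ^ 2 ≤ q ^ 3 * P.card := by
    calc ∑ l, (q * f l - P.card) ^ 2
        = ∑ l, (q ^ 2 * f l ^ 2 - 2 * q * P.card * f l + (P.card : ℤ) ^ 2) :=
          Finset.sum_congr rfl fun l _ => by ring
      _ = q ^ 2 * ∑ l, f l ^ 2 - 2 * q * P.card * ∑ l, f l + q ^ 2 * (P.card : ℤ) ^ 2 := by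
          rw [Finset.sum_add_distrib, Finset.sum_sub_distrib, ← Finset.mul_sum, ← Finset.mul_sum,
            Finset.sum_const, nsmul_eq_mul, hcardl]
      _ ≤ q ^ 2 * (q * P.card + P.card * P.card) - 2 * q * P.card * (q * P.card) +
            q ^ 2 * (P.card : ℤ) ^ 2 := by rw [hf1]; gcongr
      _ = _ := by ring
  -- A line without incidences contributes the full |P|² to the variance.
  have hzero : ∀ l ∈ X ×ˢ S, (q * f l - P.card) ^ 2 = (P.card : ℤ) ^ 2 := by
    intro l hl
    obtain ⟨hx, hs⟩ := Finset.mem_product.mp hl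
    have : f l = 0 := by
      apply Finset.sum_eq_zero
      intro p hp
      obtain ⟨hy, hu⟩ := Finset.mem_product.mp hp
      rw [if_neg (hno _ hx _ hy _ hu _ hs)]
    rw [this]; ring
  have hlow : ((X ×ˢ S).card : ℤ) * (P.card : ℤ) ^ 2 ≤ q ^ 3 * P.card := by
    refine le_trans ?_ hvar
    rw [← nsmul_eq_mul, ← Finset.sum_const, ← Finset.sum_congr rfl hzero]
    exact Finset.sum_le_sum_of_subset_of_nonneg (Finset.subset_univ _) fun _ _ _ => sq_nonneg _
  have hPpos : 0 < P.card := by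
    rw [hP, Finset.card_product]
    rcases Nat.eq_zero_or_pos (Y.card * U.card) with h0 | h0
    · rw [h0] at h; omega
    · exact h0
  have hlow' : (X ×ˢ S).card * P.card ≤ Fintype.card F ^ 3 := by
    have : ((X ×ˢ S).card * P.card * P.card : ℤ) ≤ q ^ 3 * P.card := by
      calc _ = ((X ×ˢ S).card : ℤ) * (P.card : ℤ) ^ 2 := by ring
        _ ≤ _ := hlow
    have := le_of_mul_le_mul_right this (by exact_mod_cast hPpos)
    rw [hqF] at this
    exact_mod_cast this
  rw [Finset.card_product, hP, Finset.card_product] at hlow'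
  omega

end Incidence

/-! ### Large sets fill the group in forty factors -/

section LargeSet

open scoped Pointwise

variable {F : Type*} [Field F]

/-- The upper unipotent matrix. -/
def upperU (y : F) : SL(2, F) := ⟨!![1, y; 0, 1], by simp [Matrix.det_fin_two_of]⟩

/-- The lower unipotent matrix. -/
def lowerU (y : F) : SL(2, F) := ⟨!![1, 0; y, 1], by simp [Matrix.det_fin_two_of]⟩

/-- The Weyl element. -/
def weyl : SL(2, F) := ⟨!![0, -1; 1, 0], by simp [Matrix.det_fin_two_of]⟩

theorem upperU_apply (y : F) : (upperU y).1 0 0 = 1 ∧ (upperU y).1 0 1 = y ∧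
    (upperU y).1 1 0 = 0 ∧ (upperU y).1 1 1 = 1 := by simp [upperU]

theorem lowerU_apply (y : F) : (lowerU y).1 0 0 = 1 ∧ (lowerU y).1 0 1 = 0 ∧
    (lowerU y).1 1 0 = y ∧ (lowerU y).1 1 1 = 1 := by simp [lowerU]

theorem weyl_apply : (weyl : SL(2, F)).1 0 0 = 0 ∧ (weyl : SL(2, F)).1 0 1 = -1 ∧
    (weyl : SL(2, F)).1 1 0 = 1 ∧ (weyl : SL(2, F)).1 1 1 = 0 := by simp [weyl]

theorem upperU_add (x y : F) : upperU (x + y) = upperU x * upperU y := by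
  obtain ⟨a1, a2, a3, a4⟩ := upperU_apply x
  obtain ⟨b1, b2, b3, b4⟩ := upperU_apply y
  obtain ⟨c1, c2, c3, c4⟩ := upperU_apply (x + y)
  apply SL2.ext <;> simp only [SL2.mul_apply, a1, a2, a3, a4, b1, b2, b3, b4, c1, c2, c3, c4] <;>
    ring

theorem conj_upperU {m : SL(2, F)} (hm : m.1 1 0 = 0) (y : F) :
    m * upperU y * m⁻¹ = upperU (m.1 0 0 ^ 2 * y) := by
  obtain ⟨a1, a2, a3, a4⟩ := upperU_apply y
  obtain ⟨c1, c2, c3, c4⟩ := upperU_apply (m.1 0 0 ^ 2 * y)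
  obtain ⟨i1, i2, i3, i4⟩ := SL2.inv_apply m
  have hd := SL2.det_eq m
  apply SL2.ext <;>
    simp only [SL2.mul_apply, a1, a2, a3, a4, c1, c2, c3, c4, i1, i2, i3, i4, hm] <;>
    rw [hm] at hd <;> first | linear_combination hd | ring

theorem weyl_conj_upperU (y : F) : weyl * upperU y * weyl⁻¹ = lowerU (-y) := by
  obtain ⟨a1, a2, a3, a4⟩ := upperU_apply y
  obtain ⟨c1, c2, c3, c4⟩ := lowerU_apply (-y)
  obtain ⟨i1, i2, i3, i4⟩ := SL2.inv_apply (weyl : SL(2, F))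
  obtain ⟨w1, w2, w3, w4⟩ := weyl_apply (F := F)
  apply SL2.ext <;>
    simp only [SL2.mul_apply, a1, a2, a3, a4, c1, c2, c3, c4, i1, i2, i3, i4, w1, w2, w3, w4] <;>
    ring

theorem eq_upperU_mul_lowerU_mul_upperU {m : SL(2, F)} (hm : m.1 1 0 ≠ 0) :
    ∃ x y z : F, m = upperU x * lowerU y * upperU z := by
  refine ⟨(m.1 0 0 - 1) / m.1 1 0, m.1 1 0, (m.1 1 1 - 1) / m.1 1 0, ?_⟩
  obtain ⟨a1, a2, a3, a4⟩ := upperU_apply ((m.1 0 0 - 1) / m.1 1 0)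
  obtain ⟨b1, b2, b3, b4⟩ := lowerU_apply (m.1 1 0)
  obtain ⟨c1, c2, c3, c4⟩ := upperU_apply ((m.1 1 1 - 1) / m.1 1 0)
  have hd := SL2.det_eq m
  apply SL2.ext <;>
    simp only [SL2.mul_apply, a1, a2, a3, a4, b1, b2, b3, b4, c1, c2, c3, c4] <;> field_simp
  · ring
  · linear_combination -hd
  · ring
  · ring

/-- Off the upper triangular matrices three factors suffice; right multiplication by `lowerU 1`
moves an upper triangular matrix there. -/
theorem exists_eq_unipotent_product (m : SL(2, F)) :
    ∃ x y z w : F, m = upperU x * lowerU y * upperU z * lowerU w := by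
  have hone : (lowerU (0 : F)) = 1 := by
    obtain ⟨a1, a2, a3, a4⟩ := lowerU_apply (0 : F)
    obtain ⟨b1, b2, b3, b4⟩ := SL2.one_apply (F := F)
    apply SL2.ext <;> simp only [a1, a2, a3, a4, b1, b2, b3, b4]
  by_cases hm : m.1 1 0 = 0
  · obtain ⟨b1, b2, b3, b4⟩ := lowerU_apply (1 : F)
    obtain ⟨c1, c2, c3, c4⟩ := lowerU_apply (-1 : F)
    have hd := SL2.det_eq m
    have hinv : lowerU (1 : F) * lowerU (-1) = 1 := by
      obtain ⟨e1, e2, e3, e4⟩ := SL2.one_apply (F := F)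
      apply SL2.ext <;>
        simp only [SL2.mul_apply, b1, b2, b3, b4, c1, c2, c3, c4, e1, e2, e3, e4] <;> ring
    have hne : (m * lowerU 1).1 1 0 ≠ 0 := by
      rw [SL2.mul_apply, b1, b3, hm]
      rw [hm] at hd
      intro h
      have : m.1 1 1 = 0 := by linear_combination h
      rw [this] at hd
      simp at hd
    obtain ⟨x, y, z, h⟩ := eq_upperU_mul_lowerU_mul_upperU hne
    exact ⟨x, y, z, -1, by rw [← h, mul_assoc, hinv, mul_one]⟩
  · obtain ⟨x, y, z, h⟩ := eq_upperU_mul_lowerU_mul_upperU hm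
    exact ⟨x, y, z, 0, by rw [← h, hone, mul_one]⟩

variable [DecidableEq F] [Fintype F] {A : Finset SL(2, F)}

open Classical in
-- Pigeonholing shows that A² holds many unipotents `upperU y` and upper triangular m with many
-- diagonal entries l. Conjugation by m scales y by l², and the incidence bound writes s as l²y + u
-- + y', a product of five elements of A².
theorem upperU_mem_pow (hinv : ∀ a ∈ A, a⁻¹ ∈ A)
    (hA : 4 * Fintype.card F ^ 11 < A.card ^ 4) (s : F) : upperU s ∈ A ^ 10 := by
  have hq : 0 < Fintype.card F := Fintype.card_pos
  have hmul : ∀ a ∈ A, ∀ b ∈ A, a⁻¹ * b ∈ A ^ 2 := fun a ha b hb => by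
    rw [pow_two]; exact Finset.mul_mem_mul (hinv a ha) hb
  let Y : Finset F := Finset.univ.filter fun y => upperU y ∈ A ^ 2
  let D : Finset F := Finset.univ.filter fun l => ∃ m ∈ A ^ 2, m.1 1 0 = 0 ∧ m.1 0 0 = l
  let X : Finset F := D.image fun l => l ^ 2
  -- Pigeonhole on the first column: a quotient of two elements with equal first columns is upper
  -- unipotent.
  have hY : A.card ≤ Y.card * Fintype.card F ^ 2 := by
    have := Finset.card_le_mul_card_image_of_maps_to (s := A) (t := Finset.univ)
      (f := fun a => (a.1 0 0, a.1 1 0)) (fun _ _ => Finset.mem_univ _) Y.card ?_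
    · simpa [pow_two] using this
    intro b _
    rcases Finset.eq_empty_or_nonempty (A.filter fun a => (a.1 0 0, a.1 1 0) = b) with h | ⟨a₀, h₀⟩
    · rw [h]; simp
    obtain ⟨m₀, rfl⟩ := Finset.mem_filter.mp h₀
    have key : ∀ a ∈ A.filter fun a => (a.1 0 0, a.1 1 0) = (a₀.1 0 0, a₀.1 1 0),
        a₀⁻¹ * a = upperU ((a₀⁻¹ * a).1 0 1) := by
      intro a ha
      obtain ⟨-, e⟩ := Finset.mem_filter.mp ha
      obtain ⟨e1, e2⟩ := Prod.mk.inj e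
      have hd := SL2.det_eq a₀
      have hd' := SL2.det_eq a
      obtain ⟨u1, u2, u3, u4⟩ := upperU_apply ((a₀⁻¹ * a).1 0 1)
      obtain ⟨i1, i2, i3, i4⟩ := SL2.inv_apply a₀
      refine SL2.ext ?_ u2.symm ?_ ?_
      · rw [u1, SL2.mul_apply, i1, i2, e1, e2]; linear_combination hd
      · rw [u3, SL2.mul_apply, i3, i4, e1, e2]; ring
      · rw [u4, SL2.mul_apply, i3, i4]
        rw [e1, e2] at hd'
        linear_combination hd'
    apply Finset.card_le_card_of_injOn (fun a => (a₀⁻¹ * a).1 0 1)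
    · intro a ha
      refine Finset.mem_coe.mpr (Finset.mem_filter.mpr ⟨Finset.mem_univ _, ?_⟩)
      rw [← key a ha]
      exact hmul _ m₀ _ (Finset.mem_filter.mp ha).1
    · intro a ha b hb h
      have e1 := key a ha
      have e2 := key b hb
      simp only at h
      rw [h, ← e2] at e1
      exact mul_left_cancel e1
  let slope : SL(2, F) → Option F := fun a =>
    if a.1 1 0 = 0 then none else some (a.1 0 0 / a.1 1 0)
  -- Pigeonhole on the q + 1 lines that a first column can span: quotients are then upper
  -- triangular.
  have hD : A.card ≤ D.card * Fintype.card F * (Fintype.card F + 1) := by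
    have := Finset.card_le_mul_card_image_of_maps_to (s := A) (t := Finset.univ)
      (f := slope)
      (fun _ _ => Finset.mem_univ _) (D.card * Fintype.card F) ?_
    · simpa using this
    intro b _
    rcases Finset.eq_empty_or_nonempty (A.filter fun a => slope a = b) with h | ⟨a₀, h₀⟩
    · rw [h]; simp
    obtain ⟨m₀, rfl⟩ := Finset.mem_filter.mp h₀
    obtain ⟨i1, i2, i3, i4⟩ := SL2.inv_apply a₀
    rw [← Finset.card_univ, ← Finset.card_product]
    have key : ∀ a : SL(2, F), slope a = slope a₀ → (a₀⁻¹ * a).1 1 0 = 0 := by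
      intro a e
      simp only [slope] at e
      rw [SL2.mul_apply, i3, i4]
      by_cases h1 : a.1 1 0 = 0 <;> by_cases h2 : a₀.1 1 0 = 0
      · rw [h1, h2]; ring
      · simp [h1, h2] at e
      · simp [h1, h2] at e
      · simp only [h1, h2, if_false, Option.some.injEq] at e
        field_simp at e
        linear_combination -e
    apply Finset.card_le_card_of_injOn (fun a => ((a₀⁻¹ * a).1 0 0, (a₀⁻¹ * a).1 0 1))
    · intro a ha
      obtain ⟨ha1, ha2⟩ := Finset.mem_filter.mp (Finset.mem_coe.mp ha)
      refine Finset.mem_coe.mpr (Finset.mk_mem_product ?_ (Finset.mem_univ _))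
      exact Finset.mem_filter.mpr ⟨Finset.mem_univ _, _, hmul _ m₀ _ ha1, key a ha2, rfl⟩
    · intro a ha b hb h
      have k1 := key a (Finset.mem_filter.mp (Finset.mem_coe.mp ha)).2
      have k2 := key b (Finset.mem_filter.mp (Finset.mem_coe.mp hb)).2
      obtain ⟨h0, h1⟩ := Prod.mk.inj h
      have d1 := SL2.det_eq (a₀⁻¹ * a)
      have d2 := SL2.det_eq (a₀⁻¹ * b)
      rw [k1] at d1
      rw [k2, ← h0] at d2
      have hne : (a₀⁻¹ * a).1 0 0 ≠ 0 := by
        intro h; rw [h] at d1; simp at d1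
      have h11 : (a₀⁻¹ * a).1 1 1 = (a₀⁻¹ * b).1 1 1 := by
        apply mul_left_cancel₀ hne
        linear_combination d1 - d2
      exact mul_left_cancel (SL2.ext h0 h1 (by rw [k1, k2]) h11)
  have hX : D.card ≤ 2 * X.card := by
    apply Finset.card_le_mul_card_image
    intro b _
    apply card_le_two_of_quadratic _ 1 0 (-b) (by simp)
    intro x hx
    have := (Finset.mem_filter.mp hx).2
    linear_combination this
  have hbig : Fintype.card F ^ 3 < X.card * (Y.image fun y => s - y).card * (Y.card * Y.card) := by
    rw [Finset.card_image_of_injective _ (sub_right_injective)]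
    have : 4 * Fintype.card F ^ 8 * Fintype.card F ^ 3 <
        4 * Fintype.card F ^ 8 * (X.card * Y.card * (Y.card * Y.card)) :=
      calc 4 * Fintype.card F ^ 8 * Fintype.card F ^ 3 = 4 * Fintype.card F ^ 11 := by ring
        _ < A.card ^ 4 := hA
        _ = A.card * A.card ^ 3 := by ring
        _ ≤ (D.card * Fintype.card F * (Fintype.card F + 1)) *
            (Y.card * Fintype.card F ^ 2) ^ 3 := by gcongr
        _ ≤ (2 * X.card * Fintype.card F * (Fintype.card F + Fintype.card F)) *
            (Y.card * Fintype.card F ^ 2) ^ 3 := by gcongr; omega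
        _ = _ := by ring
    exact Nat.lt_of_mul_lt_mul_left this
  obtain ⟨x, hx, y, hy, u, hu, s', hs', h⟩ := exists_mul_add_eq X Y Y _ hbig
  obtain ⟨l, hl, rfl⟩ := Finset.mem_image.mp hx
  obtain ⟨y', hy', rfl⟩ := Finset.mem_image.mp hs'
  obtain ⟨m, hm, hm10, rfl⟩ := (Finset.mem_filter.mp hl).2
  have hs : s = m.1 0 0 ^ 2 * y + u + y' := by linear_combination -h
  rw [hs, upperU_add, upperU_add, ← conj_upperU hm10]
  have : A ^ 10 = A ^ 2 * A ^ 2 * A ^ 2 * A ^ 2 * A ^ 2 := by simp only [← pow_add]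
  rw [this]
  refine Finset.mul_mem_mul (Finset.mul_mem_mul (Finset.mul_mem_mul (Finset.mul_mem_mul hm ?_)
    (inv_mem_pow hinv 2 _ hm)) ?_) ?_
  · exact (Finset.mem_filter.mp hy).2
  · exact (Finset.mem_filter.mp hu).2
  · exact (Finset.mem_filter.mp hy').2

theorem mem_pow_of_large (hinv : ∀ a ∈ A, a⁻¹ ∈ A)
    (hA : 4 * Fintype.card F ^ 11 < A.card ^ 4) (m : SL(2, F)) :
    m ∈ (A ^ 10) ^ 4 := by
  have hlow : ∀ s : F, lowerU s ∈ A ^ 10 := by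
    intro s
    -- Conjugation by the Weyl element reduces lower unipotents to upper ones.
    let φ : SL(2, F) →* SL(2, F) := (MulAut.conj (weyl⁻¹ : SL(2, F))).toMonoidHom
    have hφ : Function.Injective φ := (MulAut.conj (weyl⁻¹ : SL(2, F))).injective
    have h := upperU_mem_pow (A := A.image φ)
      (by
        intro a ha
        obtain ⟨b, hb, rfl⟩ := Finset.mem_image.mp ha
        rw [← map_inv]
        exact Finset.mem_image_of_mem _ (hinv b hb))
      (by rwa [Finset.card_image_of_injective _ hφ]) (-s)
    rw [← Finset.image_pow] at h
    obtain ⟨b, hb, e⟩ := Finset.mem_image.mp h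
    have e' : weyl⁻¹ * b * weyl = upperU (-s) := by
      rw [← e]
      simp [φ]
    have : b = lowerU s := by
      rw [← neg_neg s, ← weyl_conj_upperU, ← e']
      group
    rwa [← this]
  have hup := upperU_mem_pow hinv hA
  rw [pow_succ, pow_succ, pow_two]
  obtain ⟨x, y, z, w, rfl⟩ := exists_eq_unipotent_product m
  exact Finset.mul_mem_mul (Finset.mul_mem_mul (Finset.mul_mem_mul (hup x) (hlow y)) (hup z))
    (hlow w)

end LargeSet

/-! ### Words as polynomials in a unipotent shift -/

section Words

open Polynomial

variable {F : Type*} [Field F]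

/-- The element of the pair `x` denoted by a letter. -/
def letter (x : SL(2, F) × SL(2, F)) (b : Bool) : SL(2, F) := if b then x.1 else x.2

/-- The value at the pair `x` of a positive word in two letters. -/
def wordVal (x : SL(2, F) × SL(2, F)) (w : List Bool) : SL(2, F) := (w.map (letter x)).prod

theorem wordVal_cons (x : SL(2, F) × SL(2, F)) (b : Bool) (w : List Bool) :
    wordVal x (b :: w) = letter x b * wordVal x w := by simp [wordVal]

/-- Translation of a pair by a unipotent matrix on the right. -/
def pairShift (s : F) : SL(2, F) × SL(2, F) ≃ SL(2, F) × SL(2, F) :=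
  (Equiv.mulRight (upperU s)).prodCongr (Equiv.mulRight (upperU s))

theorem letter_pairShift (s : F) (x : SL(2, F) × SL(2, F)) (b : Bool) :
    letter (pairShift s x) b = letter x b * upperU s := by
  cases b <;> simp [letter, pairShift]

theorem mul_upperU_apply (g : SL(2, F)) (s : F) (i : Fin 2) :
    (g * upperU s).1 i 0 = g.1 i 0 ∧ (g * upperU s).1 i 1 = g.1 i 0 * s + g.1 i 1 := by
  obtain ⟨a1, a2, a3, a4⟩ := upperU_apply s
  simp only [SL2.mul_apply, a1, a2, a3, a4]
  constructor <;> ring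

/-- The second column of the value of a word at `pairShift s x`, as a polynomial in `s`. -/
noncomputable def wordPoly (x : SL(2, F) × SL(2, F)) : List Bool → Fin 2 → F[X]
  | [] => ![0, 1]
  | b :: w => fun i => C ((letter x b).1 i 0) * (wordPoly x w 0 + X * wordPoly x w 1) +
      C ((letter x b).1 i 1) * wordPoly x w 1

theorem wordPoly_eval (x : SL(2, F) × SL(2, F)) (s : F) (w : List Bool) (i : Fin 2) :
    (wordPoly x w i).eval s = (wordVal (pairShift s x) w).1 i 1 := by
  induction w generalizing i with
  | nil => fin_cases i <;> simp [wordPoly, wordVal]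
  | cons b w ih =>
    rw [wordVal_cons, SL2.mul_apply, letter_pairShift]
    obtain ⟨h0, h1⟩ := mul_upperU_apply (letter x b) s i
    rw [h0, h1, ← ih, ← ih, wordPoly]
    simp
    ring

theorem wordPoly_natDegree_le (x : SL(2, F) × SL(2, F)) (w : List Bool) (i : Fin 2) :
    (wordPoly x w i).natDegree ≤ w.length := by
  induction w generalizing i with
  | nil => fin_cases i <;> simp [wordPoly]
  | cons b w ih =>
    rw [wordPoly, List.length_cons]
    have h0 := ih 0
    have h1 := ih 1
    have hX : (X * wordPoly x w 1).natDegree ≤ w.length + 1 := by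
      refine natDegree_mul_le.trans ?_
      have := natDegree_X_le (R := F)
      omega
    refine natDegree_add_le_of_degree_le ((natDegree_C_mul_le _ _).trans ?_)
      ((natDegree_C_mul_le _ _).trans (by omega))
    exact natDegree_add_le_of_degree_le (by omega) hX

theorem wordPoly_cons_coeff (x : SL(2, F) × SL(2, F)) (b : Bool) (w : List Bool) (i : Fin 2) :
    (wordPoly x (b :: w) i).coeff (w.length + 1) =
      (letter x b).1 i 0 * (wordPoly x w 1).coeff w.length := by
  have h0 : (wordPoly x w 0).coeff (w.length + 1) = 0 :=
    coeff_eq_zero_of_natDegree_lt (Nat.lt_succ_of_le (wordPoly_natDegree_le x w 0))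
  have h1 : (wordPoly x w 1).coeff (w.length + 1) = 0 :=
    coeff_eq_zero_of_natDegree_lt (Nat.lt_succ_of_le (wordPoly_natDegree_le x w 1))
  rw [wordPoly, coeff_add, coeff_C_mul, coeff_C_mul, coeff_add, coeff_X_mul, h0, h1]
  ring

/-- The top coefficient is the product of the lower left entries of the letters. -/
theorem wordPoly_coeff_ne_zero (x : SL(2, F) × SL(2, F)) (w : List Bool)
    (h : ∀ b ∈ w, (letter x b).1 1 0 ≠ 0) : (wordPoly x w 1).coeff w.length ≠ 0 := by
  induction w with
  | nil => simp [wordPoly]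
  | cons b w ih =>
    rw [List.length_cons, wordPoly_cons_coeff]
    exact mul_ne_zero (h b (by simp)) (ih fun c hc => h c (by simp [hc]))

theorem card_filter_le_of_polynomial [Fintype F] (P : F[X]) (n : ℕ) (hn : P.natDegree ≤ n)
    (h0 : P ≠ 0) (Q : F → Prop) [DecidablePred Q] (hQ : ∀ s, Q s → P.eval s = 0) :
    (Finset.univ.filter Q).card ≤ n := by
  classical
  calc (Finset.univ.filter Q).card ≤ P.roots.toFinset.card := by
        apply Finset.card_le_card
        intro s hs
        rw [Multiset.mem_toFinset, mem_roots h0]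
        exact hQ s (Finset.mem_filter.mp hs).2
    _ ≤ P.roots.card := Multiset.toFinset_card_le _
    _ ≤ P.natDegree := card_roots' P
    _ ≤ n := hn

/-- Neither element of the pair fixes the first basis line, and they move it to different lines. -/
def PairGeneric (x : SL(2, F) × SL(2, F)) : Prop :=
  x.1.1 1 0 ≠ 0 ∧ x.2.1 1 0 ≠ 0 ∧ x.1.1 0 0 * x.2.1 1 0 - x.1.1 1 0 * x.2.1 0 0 ≠ 0

theorem pairGeneric_shift (s : F) (x : SL(2, F) × SL(2, F)) :
    PairGeneric (pairShift s x) ↔ PairGeneric x := by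
  have h1 := fun i => (mul_upperU_apply x.1 s i).1
  have h2 := fun i => (mul_upperU_apply x.2 s i).1
  have e1 : (pairShift s x).1 = x.1 * upperU s := rfl
  have e2 : (pairShift s x).2 = x.2 * upperU s := rfl
  rw [PairGeneric, e1, e2, h1, h1, h2, h2, PairGeneric]

/-- After cancelling the common prefix the words begin with different letters. Their top
coefficients are nonzero multiples of the first columns of those letters, which are not parallel, so
some entry of the difference is a nonzero polynomial. -/
theorem card_wordVal_eq_le [Fintype F] [DecidableEq F] {x : SL(2, F) × SL(2, F)} (hx : PairGeneric x)
    (w w' : List Bool) (hlen : w.length = w'.length) (hne : w ≠ w') :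
    (Finset.univ.filter fun s => wordVal (pairShift s x) w = wordVal (pairShift s x) w').card
      ≤ w.length := by
  induction w generalizing w' with
  | nil =>
    exact absurd (List.length_eq_zero_iff.mp hlen.symm).symm hne
  | cons b v ih =>
    cases w' with
    | nil => simp at hlen
    | cons b' v' =>
      have hlen' : v.length = v'.length := by simpa using hlen
      by_cases hb : b = b'
      · subst hb
        have hv : v ≠ v' := fun h => hne (by rw [h])
        have := ih v' hlen' hv
        simp only [wordVal_cons, mul_right_inj]
        exact this.trans (by simp)
      obtain ⟨h1, h2, h3⟩ := hx
      have hl : ∀ c, (letter x c).1 1 0 ≠ 0 := by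
        intro c; cases c <;> simpa [letter]
      have hα := wordPoly_coeff_ne_zero x v fun c _ => hl c
      have hβ := wordPoly_coeff_ne_zero x v' fun c _ => hl c
      have hcross : (letter x b).1 0 0 * (letter x b').1 1 0 -
          (letter x b).1 1 0 * (letter x b').1 0 0 ≠ 0 := by
        cases b <;> cases b' <;> simp only [letter, not_true_eq_false] at hb ⊢
        · intro h; apply h3; simp at h; linear_combination -h
        · simpa using h3
      obtain ⟨i, hi⟩ : ∃ i, (wordPoly x (b :: v) i - wordPoly x (b' :: v') i).coeff
          (v.length + 1) ≠ 0 := by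
        by_contra! hall
        have c0 := hall 0
        have c1 := hall 1
        rw [coeff_sub, wordPoly_cons_coeff, hlen', wordPoly_cons_coeff, ← hlen'] at c0 c1
        apply mul_ne_zero hα hcross
        linear_combination (letter x b').1 1 0 * c0 - (letter x b').1 0 0 * c1
      apply card_filter_le_of_polynomial (wordPoly x (b :: v) i - wordPoly x (b' :: v') i)
      · apply (natDegree_sub_le _ _).trans
        apply max_le (wordPoly_natDegree_le x _ i)
        rw [hlen]
        exact wordPoly_natDegree_le x _ i
      · intro h
        rw [h] at hi
        simp at hi
      · intro s hs
        rw [eval_sub, wordPoly_eval, wordPoly_eval, hs, sub_self]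

/-- The entry is a polynomial in s with top coefficient g₀₀ g₁₀^(k-1). -/
theorem card_pow_apply_eq_zero_le [Fintype F] [DecidableEq F] {g : SL(2, F)} (h0 : g.1 0 0 ≠ 0) (h1 : g.1 1 0 ≠ 0)
    {k : ℕ} (hk : 0 < k) :
    (Finset.univ.filter fun s => ((g * upperU s) ^ k).1 0 1 = 0).card ≤ k := by
  obtain ⟨k, rfl⟩ : ∃ j, k = j + 1 := ⟨k - 1, by omega⟩
  apply card_filter_le_of_polynomial (wordPoly (g, g) (List.replicate (k + 1) true) 0)
  · simpa using wordPoly_natDegree_le (g, g) (List.replicate (k + 1) true) 0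
  · intro h
    have h2 := wordPoly_cons_coeff (g, g) true (List.replicate k true) 0
    rw [← List.replicate_succ, h, coeff_zero] at h2
    refine mul_ne_zero ?_ (wordPoly_coeff_ne_zero (g, g) (List.replicate k true) ?_) h2.symm
    · simpa [letter] using h0
    · intro b _
      cases b <;> simpa [letter] using h1
  · intro s hs
    rw [wordPoly_eval]
    have : wordVal (pairShift s (g, g)) (List.replicate (k + 1) true) = (g * upperU s) ^ (k + 1) := by
      rw [wordVal, List.map_replicate, List.prod_replicate, letter_pairShift]
      simp [letter]
    rw [this, hs]

end Words

/-! ### Counting pairs outside general position -/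

section BadPairs

/-- Averaging over a family of bijections: a property that is rare along every orbit is rare. -/
theorem card_mul_card_filter_le {X S : Type*} [Fintype X] [Fintype S] (φ : S → X ≃ X)
    (P : X → Prop) [DecidablePred P] (K : ℕ) (h : ∀ x, (Finset.univ.filter fun s => P (φ s x)).card ≤ K) :
    Fintype.card S * (Finset.univ.filter P).card ≤ K * Fintype.card X := by
  have h1 : ∀ s, (Finset.univ.filter fun x => P (φ s x)).card = (Finset.univ.filter P).card := by
    intro s
    apply Finset.card_bij (fun x _ => φ s x)
    · intro x hx; simpa using hx
    · intro x _ y _ hxy; exact (φ s).injective hxy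
    · intro y hy
      exact ⟨(φ s).symm y, by simpa using hy, by simp⟩
  calc Fintype.card S * (Finset.univ.filter P).card
      = ∑ s : S, (Finset.univ.filter fun x => P (φ s x)).card := by simp [h1]
    _ = ∑ x : X, (Finset.univ.filter fun s => P (φ s x)).card := by
        simp only [Finset.card_filter]
        exact Finset.sum_comm
    _ ≤ ∑ _x : X, K := Finset.sum_le_sum fun x _ => h x
    _ = K * Fintype.card X := by simp [mul_comm]

variable {F : Type*} [Field F] [Fintype F] [DecidableEq F]

theorem card_lower_left_eq_zero_le :
    (Finset.univ.filter fun m : SL(2, F) => m.1 1 0 = 0).card ≤ Fintype.card F ^ 2 := by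
  rw [pow_two, ← Fintype.card_prod, ← Finset.card_univ]
  apply Finset.card_le_card_of_injOn (fun m => (m.1 0 0, m.1 0 1)) (fun _ _ => Finset.mem_univ _)
  intro m hm n hn h
  have hm' := (Finset.mem_filter.mp (Finset.mem_coe.mp hm)).2
  have hn' := (Finset.mem_filter.mp (Finset.mem_coe.mp hn)).2
  obtain ⟨h0, h1⟩ := Prod.mk.inj h
  have dm := SL2.det_eq m
  have dn := SL2.det_eq n
  rw [hm'] at dm
  rw [hn', ← h0] at dn
  have hne : m.1 0 0 ≠ 0 := by intro h; rw [h] at dm; simp at dm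
  refine SL2.ext h0 h1 (by rw [hm', hn']) ?_
  apply mul_left_cancel₀ hne
  linear_combination dm - dn

theorem card_tr_eq_le (t : F) :
    (Finset.univ.filter fun m : SL(2, F) => SL2.tr m = t).card ≤ 2 * Fintype.card F ^ 2 := by
  have h1 : (Finset.univ.filter fun m : SL(2, F) => SL2.tr m = t ∧ m.1 1 0 ≠ 0).card ≤
      Fintype.card F ^ 2 := by
    rw [pow_two, ← Fintype.card_prod, ← Finset.card_univ]
    apply Finset.card_le_card_of_injOn (fun m => (m.1 0 0, m.1 1 0))
      (fun _ _ => Finset.mem_univ _)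
    intro m hm n hn h
    obtain ⟨-, hm1, hm2⟩ := Finset.mem_filter.mp (Finset.mem_coe.mp hm)
    obtain ⟨-, hn1, hn2⟩ := Finset.mem_filter.mp (Finset.mem_coe.mp hn)
    obtain ⟨h0, h1⟩ := Prod.mk.inj h
    have dm := SL2.det_eq m
    have dn := SL2.det_eq n
    rw [SL2.tr] at hm1 hn1
    have h11 : m.1 1 1 = n.1 1 1 := by linear_combination hm1 - hn1 - h0
    rw [← h0, ← h1, ← h11] at dn
    refine SL2.ext h0 ?_ h1 h11
    apply mul_right_cancel₀ hm2
    linear_combination dn - dm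
  have h2 := card_lower_left_eq_zero_le (F := F)
  have h3 : (Finset.univ.filter fun m : SL(2, F) => SL2.tr m = t) ⊆
      (Finset.univ.filter fun m : SL(2, F) => SL2.tr m = t ∧ m.1 1 0 ≠ 0) ∪
      (Finset.univ.filter fun m : SL(2, F) => m.1 1 0 = 0) := by
    intro m hm
    by_cases h : m.1 1 0 = 0
    · exact Finset.mem_union_right _ (by simpa using h)
    · exact Finset.mem_union_left _ (by simpa [h] using hm)
  have h4 := Finset.card_le_card h3
  have h5 := Finset.card_union_le
      (Finset.univ.filter fun m : SL(2, F) => SL2.tr m = t ∧ m.1 1 0 ≠ 0)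
      (Finset.univ.filter fun m : SL(2, F) => m.1 1 0 = 0)
  omega

/-- A pair in general position whose positive words of length `n` take distinct values. -/
structure GoodPair (n : ℕ) (x : SL(2, F) × SL(2, F)) : Prop where
  generic : PairGeneric x
  tr_ne_zero : SL2.tr x.1 ≠ 0
  tr_sq_ne_four : SL2.tr x.1 ^ 2 ≠ 4
  injective : Function.Injective fun w : Fin n → Bool => wordVal x (List.ofFn w)

theorem card_fst_filter_le (P : SL(2, F) → Prop) [DecidablePred P] (K : ℕ)
    (h : (Finset.univ.filter P).card ≤ K) :
    (Finset.univ.filter fun x : SL(2, F) × SL(2, F) => P x.1).card ≤ K * Fintype.card F ^ 3 := by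
  have : (Finset.univ.filter fun x : SL(2, F) × SL(2, F) => P x.1) =
      (Finset.univ.filter P) ×ˢ Finset.univ := by
    ext x; simp
  rw [this, Finset.card_product, Finset.card_univ]
  exact Nat.mul_le_mul h card_SL2_le

theorem card_equiv_fst_filter_le (φ : SL(2, F) × SL(2, F) ≃ SL(2, F) × SL(2, F))
    (P : SL(2, F) → Prop) [DecidablePred P] (K : ℕ) (h : (Finset.univ.filter P).card ≤ K) :
    (Finset.univ.filter fun x : SL(2, F) × SL(2, F) => P (φ x).1).card ≤ K * Fintype.card F ^ 3 := by
  refine le_trans ?_ (card_fst_filter_le P K h)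
  apply Finset.card_le_card_of_injOn φ
  · intro x hx; simpa using hx
  · exact φ.injective.injOn

/-- A pair in general position for which two positive words of length `n` take the same value. -/
def PairCollides (n : ℕ) (x : SL(2, F) × SL(2, F)) : Prop := PairGeneric x ∧
  ∃ p : (Fin n → Bool) × (Fin n → Bool), p.1 ≠ p.2 ∧
    wordVal x (List.ofFn p.1) = wordVal x (List.ofFn p.2)

open Classical in
-- Each of the 4^n pairs of words collides for at most n values of the shift.
theorem card_pairCollides_le (n : ℕ) :
    (Finset.univ.filter fun x : SL(2, F) × SL(2, F) => PairCollides n x).card ≤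
      n * 4 ^ n * Fintype.card F ^ 5 := by
  have h1 := card_mul_card_filter_le (pairShift (F := F)) (PairCollides n) (n * 4 ^ n) ?_
  · have hq : 0 < Fintype.card F := Fintype.card_pos
    apply Nat.le_of_mul_le_mul_left _ hq
    calc _ ≤ _ := h1
      _ ≤ n * 4 ^ n * (Fintype.card F ^ 3 * Fintype.card F ^ 3) := by
        rw [Fintype.card_prod]
        exact Nat.mul_le_mul_left _ (Nat.mul_le_mul card_SL2_le card_SL2_le)
      _ = _ := by ring
  intro x
  by_cases hx : PairGeneric x
  · calc (Finset.univ.filter fun s => PairCollides n (pairShift s x)).card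
        ≤ ((Finset.univ : Finset ((Fin n → Bool) × (Fin n → Bool))).biUnion fun p =>
          Finset.univ.filter fun s => p.1 ≠ p.2 ∧ wordVal (pairShift s x) (List.ofFn p.1) =
            wordVal (pairShift s x) (List.ofFn p.2)).card := by
          apply Finset.card_le_card
          intro s hs
          obtain ⟨-, -, p, hp⟩ := Finset.mem_filter.mp hs
          exact Finset.mem_biUnion.mpr ⟨p, Finset.mem_univ _, by simpa using hp⟩
      _ ≤ (Finset.univ : Finset ((Fin n → Bool) × (Fin n → Bool))).card * n := by
          apply Finset.card_biUnion_le_card_mul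
          intro p _
          by_cases hp : p.1 = p.2
          · simp [hp]
          · have := card_wordVal_eq_le hx (List.ofFn p.1) (List.ofFn p.2) (by simp)
              (fun h => hp (List.ofFn_injective h))
            simpa [hp] using this
      _ = n * 4 ^ n := by
          rw [Finset.card_univ, Fintype.card_prod, Fintype.card_fun, Fintype.card_bool,
            Fintype.card_fin, ← mul_pow, mul_comm]
          norm_num
  · have : (Finset.univ.filter fun s => PairCollides n (pairShift s x)) = ∅ := by
      rw [Finset.filter_eq_empty_iff]
      rintro s - ⟨h, -⟩
      exact hx ((pairGeneric_shift s x).mp h)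
    rw [this]
    simp

open Classical in
-- Besides collisions, each of the three conditions in `PairGeneric` costs q⁵ and each of the traces
-- 0, 2, -2 costs 2q⁵, nine in all.
theorem card_not_goodPair_le (n : ℕ) :
    (Finset.univ.filter fun x : SL(2, F) × SL(2, F) => ¬ GoodPair n x).card ≤
      (n * 4 ^ n + 9) * Fintype.card F ^ 5 := by
  have hColl : (Finset.univ.filter (PairCollides (F := F) n)).card ≤
      n * 4 ^ n * Fintype.card F ^ 5 := card_pairCollides_le n
  let P₀ : SL(2, F) → Prop := fun m => m.1 1 0 = 0
  have b1 := card_fst_filter_le P₀ _ card_lower_left_eq_zero_le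
  have b2 := card_equiv_fst_filter_le (Equiv.prodComm _ _) P₀ _ card_lower_left_eq_zero_le
  -- g⁻¹h fixes the first basis line exactly when g and h send it to the same line.
  let ψ : SL(2, F) × SL(2, F) ≃ SL(2, F) × SL(2, F) :=
    { toFun := fun x => (x.1⁻¹ * x.2, x.1)
      invFun := fun x => (x.2, x.2 * x.1)
      left_inv := fun x => by simp
      right_inv := fun x => by simp }
  have b3 := card_equiv_fst_filter_le ψ P₀ _ card_lower_left_eq_zero_le
  have t0 := card_fst_filter_le (fun m : SL(2, F) => SL2.tr m = 0) _ (card_tr_eq_le 0)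
  have t2 := card_fst_filter_le (fun m : SL(2, F) => SL2.tr m = 2) _ (card_tr_eq_le 2)
  have t3 := card_fst_filter_le (fun m : SL(2, F) => SL2.tr m = -2) _ (card_tr_eq_le (-2))
  set B1 := Finset.univ.filter fun x : SL(2, F) × SL(2, F) => P₀ x.1
  set B2 := Finset.univ.filter fun x : SL(2, F) × SL(2, F) => P₀ ((Equiv.prodComm _ _) x).1
  set B3 := Finset.univ.filter fun x : SL(2, F) × SL(2, F) => P₀ (ψ x).1
  set T0 := Finset.univ.filter fun x : SL(2, F) × SL(2, F) => SL2.tr x.1 = 0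
  set T2 := Finset.univ.filter fun x : SL(2, F) × SL(2, F) => SL2.tr x.1 = 2
  set T3 := Finset.univ.filter fun x : SL(2, F) × SL(2, F) => SL2.tr x.1 = -2
  have hcov : (Finset.univ.filter fun x : SL(2, F) × SL(2, F) => ¬ GoodPair n x) ⊆
      Finset.univ.filter (PairCollides n) ∪ (B1 ∪ (B2 ∪ (B3 ∪ (T0 ∪ (T2 ∪ T3))))) := by
    intro x hx
    by_contra hcon
    simp only [Finset.mem_union, not_or, B1, B2, B3, T0, T2, T3, Finset.mem_filter,
      Finset.mem_univ, true_and] at hcon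
    obtain ⟨hC, h1, h2, h3, ht0, ht2, ht3⟩ := hcon
    have hgen : PairGeneric x := by
      refine ⟨h1, h2, fun h => h3 ?_⟩
      obtain ⟨i1, i2, i3, i4⟩ := SL2.inv_apply x.1
      change (x.1⁻¹ * x.2).1 1 0 = 0
      rw [SL2.mul_apply, i3, i4]
      linear_combination h
    refine (Finset.mem_filter.mp hx).2 ⟨hgen, ht0, fun h => ?_, fun w w' h => ?_⟩
    · have : (SL2.tr x.1 - 2) * (SL2.tr x.1 + 2) = 0 := by linear_combination h
      rcases mul_eq_zero.mp this with h | h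
      · exact ht2 (by linear_combination h)
      · exact ht3 (by linear_combination h)
    · by_contra hne
      exact hC ⟨hgen, (w, w'), hne, h⟩
  have c0 := Finset.card_le_card hcov
  have c1 := Finset.card_union_le (Finset.univ.filter (PairCollides n)) (B1 ∪ (B2 ∪ (B3 ∪ (T0 ∪ (T2 ∪ T3)))))
  have c2 := Finset.card_union_le B1 (B2 ∪ (B3 ∪ (T0 ∪ (T2 ∪ T3))))
  have c3 := Finset.card_union_le B2 (B3 ∪ (T0 ∪ (T2 ∪ T3)))
  have c4 := Finset.card_union_le B3 (T0 ∪ (T2 ∪ T3))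
  have c5 := Finset.card_union_le T0 (T2 ∪ T3)
  have c6 := Finset.card_union_le T2 T3
  have e5 : Fintype.card F ^ 5 = Fintype.card F ^ 2 * Fintype.card F ^ 3 := by ring
  rw [add_mul]
  rw [e5] at hColl ⊢
  rw [mul_assoc] at t0 t2 t3
  omega

end BadPairs

/-! ### Subgroups containing a transvection -/

section Generation

theorem upperU_pow {F : Type*} [Field F] (y : F) (n : ℕ) : upperU y ^ n = upperU (n * y) := by
  induction n with
  | zero =>
    rw [pow_zero]
    apply SL2.ext <;> simp [upperU]
  | succ n ih => rw [pow_succ, ih, ← upperU_add]; congr 1; push_cast; ring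

theorem lowerU_pow {F : Type*} [Field F] (y : F) (n : ℕ) : lowerU y ^ n = lowerU (n * y) := by
  have h : ∀ z : F, lowerU z = weyl * upperU (-z) * weyl⁻¹ := fun z => by
    rw [weyl_conj_upperU, neg_neg]
  rw [h, conj_pow, upperU_pow, h]
  congr 3
  ring

variable {p : ℕ} [Fact p.Prime]

/-- Over a prime field the powers of one nontrivial unipotent give all of its root subgroup.
Stripping upper unipotents from g leaves a nontrivial lower one, and the two root subgroups
generate. -/
theorem subgroup_eq_top_of_upperU_mem {H : Subgroup SL(2, ZMod p)} {y : ZMod p} (hy : y ≠ 0)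
    (hu : upperU y ∈ H) {g : SL(2, ZMod p)} (hg : g ∈ H) (hg10 : g.1 1 0 ≠ 0) : H = ⊤ := by
  have hmul : ∀ z : ZMod p, z ≠ 0 → ∀ s : ZMod p, ((s / z).val : ZMod p) * z = s := by
    intro z hz s
    rw [ZMod.natCast_val, ZMod.cast_id', id, div_mul_cancel₀ _ hz]
  have hU : ∀ s, upperU s ∈ H := by
    intro s
    rw [← hmul y hy s, ← upperU_pow]
    exact H.pow_mem hu _
  obtain ⟨x, c, z, h⟩ := eq_upperU_mul_lowerU_mul_upperU hg10
  have hc : c ≠ 0 := by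
    rintro rfl
    apply hg10
    obtain ⟨-, -, a3, a4⟩ := upperU_apply x
    obtain ⟨b1, b2, b3, b4⟩ := lowerU_apply (0 : ZMod p)
    obtain ⟨c1, -, c3, -⟩ := upperU_apply z
    rw [h]
    simp only [SL2.mul_apply, a3, a4, b1, b2, b3, b4, c1, c3]
    ring
  have hl : lowerU c ∈ H := by
    have : lowerU c = (upperU x)⁻¹ * g * (upperU z)⁻¹ := by rw [h]; group
    rw [this]
    exact H.mul_mem (H.mul_mem (H.inv_mem (hU x)) hg) (H.inv_mem (hU z))
  have hL : ∀ s, lowerU s ∈ H := by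
    intro s
    rw [← hmul c hc s, ← lowerU_pow]
    exact H.pow_mem hl _
  rw [eq_top_iff]
  intro m _
  obtain ⟨x, y, z, w, rfl⟩ := exists_eq_unipotent_product m
  exact H.mul_mem (H.mul_mem (H.mul_mem (hU x) (hL y)) (hU z)) (hL w)

/-- The transvection with parameter `y` fixing the point `x` of the affine line. -/
def transvectionAt {F : Type*} [Field F] (x y : F) : SL(2, F) :=
  frame (some x) * upperU y * (frame (some x))⁻¹

theorem transvectionAt_apply {F : Type*} [Field F] (x y : F) :
    (transvectionAt x y).1 0 0 = 1 - x * y ∧ (transvectionAt x y).1 0 1 = x ^ 2 * y ∧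
    (transvectionAt x y).1 1 0 = -y ∧ (transvectionAt x y).1 1 1 = 1 + x * y := by
  obtain ⟨i1, i2, i3, i4⟩ := SL2.inv_apply (frame (some x))
  obtain ⟨a1, a2, a3, a4⟩ := upperU_apply y
  have f1 : (frame (some x)).1 0 0 = x := by simp [frame]
  have f2 : (frame (some x)).1 0 1 = -1 := by simp [frame]
  have f3 : (frame (some x)).1 1 0 = 1 := by simp [frame]
  have f4 : (frame (some x)).1 1 1 = 0 := by simp [frame]
  simp only [transvectionAt, SL2.mul_apply, i1, i2, i3, i4, a1, a2, a3, a4, f1, f2, f3, f4]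
  refine ⟨?_, ?_, ?_, ?_⟩ <;> ring

theorem subgroup_eq_top_of_transvectionAt_mem {H : Subgroup SL(2, ZMod p)} {x y : ZMod p}
    (hy : y ≠ 0) (hu : transvectionAt x y ∈ H) {g : SL(2, ZMod p)} (hg : g ∈ H)
    (hgx : ¬ Fixes (some x) g) : H = ⊤ := by
  let k := frame (some x)
  have h : H.comap (MulAut.conj k).toMonoidHom = ⊤ := by
    apply subgroup_eq_top_of_upperU_mem hy (g := k⁻¹ * g * k)
    · rw [Subgroup.mem_comap]
      exact hu
    · rw [Subgroup.mem_comap]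
      have : (MulAut.conj k).toMonoidHom (k⁻¹ * g * k) = g := by
        simp [mul_assoc]
      rwa [this]
    · exact hgx
  rw [eq_top_iff]
  intro m _
  have : k⁻¹ * m * k ∈ H.comap (MulAut.conj k).toMonoidHom := by rw [h]; trivial
  rw [Subgroup.mem_comap] at this
  have e : (MulAut.conj k).toMonoidHom (k⁻¹ * m * k) = m := by simp [mul_assoc]
  rwa [e] at this

end Generation

/-! ### A lower bound for the number of generating pairs -/

section GeneratingCount

theorem mul_card_le_card_biUnion {α : Type*} [DecidableEq α] (s : ℕ → Finset α) (v K : ℕ)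
    (J : ℕ) (hv : ∀ j < J, v ≤ (s j).card) (hK : ∀ i j, i < j → j < J → (s i ∩ s j).card ≤ K) :
    J * v ≤ ((Finset.range J).biUnion s).card + J ^ 2 * K := by
  induction J with
  | zero => simp
  | succ J ih =>
    have ih' := ih (fun j hj => hv j (by omega)) (fun i j hij hj => hK i j hij (by omega))
    have hset : (Finset.range (J + 1)).biUnion s = s J ∪ (Finset.range J).biUnion s := by
      rw [Finset.range_add_one, Finset.biUnion_insert]
    have h1 := Finset.card_union_add_card_inter (s J) ((Finset.range J).biUnion s)
    rw [← hset] at h1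
    have h2 : (s J ∩ (Finset.range J).biUnion s).card ≤ J * K := by
      rw [Finset.inter_comm, Finset.biUnion_inter]
      calc _ ≤ (Finset.range J).card * K := Finset.card_biUnion_le_card_mul _ _ _ fun j hj =>
            hK j J (Finset.mem_range.mp hj) (by omega)
        _ = J * K := by rw [Finset.card_range]
    have h3 := hv J (by omega)
    have h4 : (J + 1) ^ 2 * K = J ^ 2 * K + J * K + J * K + K := by ring
    rw [add_mul, h4]
    omega

variable {F : Type*} [Field F] [Fintype F] [DecidableEq F]

/-- For a fixed upper right entry the two traces are linear conditions that leave only the upper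
left entry free, and det u = 1 is a quadratic in it with leading coefficient -m₀₁. -/
theorem card_tr_eq_two_le {m : SL(2, F)} (hm : m.1 0 1 ≠ 0) (T : Finset SL(2, F))
    (hT : ∀ u ∈ T, SL2.tr u = 2 ∧ SL2.tr (m * u) = 2) : T.card ≤ 2 * Fintype.card F := by
  have := Finset.card_le_mul_card_image_of_maps_to (s := T) (t := Finset.univ)
    (f := fun u => u.1 0 1) (fun _ _ => Finset.mem_univ _) 2 ?_
  · simpa using this
  intro y _
  have hprop : ∀ u ∈ T.filter (fun u => u.1 0 1 = y), u.1 0 1 = y ∧ u.1 1 1 = 2 - u.1 0 0 ∧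
      m.1 0 1 * u.1 1 0 = 2 - m.1 1 0 * y - m.1 0 0 * u.1 0 0 - m.1 1 1 * (2 - u.1 0 0) := by
    intro u hu
    obtain ⟨h1, h2⟩ := Finset.mem_filter.mp hu
    obtain ⟨t1, t2⟩ := hT u h1
    rw [SL2.tr] at t1
    rw [SL2.tr, SL2.mul_apply, SL2.mul_apply] at t2
    have h11 : u.1 1 1 = 2 - u.1 0 0 := by linear_combination t1
    refine ⟨h2, h11, ?_⟩
    rw [h2, h11] at t2
    linear_combination t2
  have hinj : Set.InjOn (fun u : SL(2, F) => u.1 0 0) (T.filter fun u => u.1 0 1 = y) := by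
    intro u hu w hw h
    obtain ⟨a1, a2, a3⟩ := hprop u hu
    obtain ⟨b1, b2, b3⟩ := hprop w hw
    simp only at h
    refine SL2.ext h (a1.trans b1.symm) ?_ (by rw [a2, b2, h])
    apply mul_left_cancel₀ hm
    rw [a3, b3, h]
  rw [← Finset.card_image_of_injOn hinj]
  apply card_le_two_of_quadratic _ (-m.1 0 1) (2 * m.1 0 1 + y * m.1 0 0 - y * m.1 1 1)
    (-2 * y + m.1 1 0 * y ^ 2 + 2 * y * m.1 1 1 - m.1 0 1)
  · rintro ⟨h, -, -⟩
    exact hm (neg_eq_zero.mp h)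
  · intro x hx
    obtain ⟨u, hu, rfl⟩ := Finset.mem_image.mp hx
    obtain ⟨a1, a2, a3⟩ := hprop u hu
    have hd := SL2.det_eq u
    rw [a1, a2] at hd
    linear_combination m.1 0 1 * hd + y * a3

/-- No positive power of `g` below the `J`-th is lower triangular. -/
def PowGeneric (J : ℕ) (g : SL(2, F)) : Prop := ∀ k, 0 < k → k < J → (g ^ k).1 0 1 ≠ 0

open Classical in
theorem card_not_powGeneric_le (J : ℕ) :
    (Finset.univ.filter fun g : SL(2, F) => ¬ PowGeneric J g).card ≤
      (J ^ 2 + 2) * Fintype.card F ^ 2 := by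
  have h10 := card_lower_left_eq_zero_le (F := F)
  have h00 : (Finset.univ.filter fun m : SL(2, F) => m.1 0 0 = 0).card ≤ Fintype.card F ^ 2 := by
    refine le_trans ?_ h10
    apply Finset.card_le_card_of_injOn (fun m => weyl * m)
    · intro m hm
      obtain ⟨w1, w2, w3, w4⟩ := weyl_apply (F := F)
      have := (Finset.mem_filter.mp (Finset.mem_coe.mp hm)).2
      refine Finset.mem_coe.mpr (Finset.mem_filter.mpr ⟨Finset.mem_univ _, ?_⟩)
      rw [SL2.mul_apply, w3, w4, this]
      ring
    · exact (mul_right_injective _).injOn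
  have horb := card_mul_card_filter_le (fun s : F => Equiv.mulRight (upperU s))
    (fun g : SL(2, F) => (g.1 0 0 ≠ 0 ∧ g.1 1 0 ≠ 0) ∧ ¬ PowGeneric J g) (J ^ 2) (by
    intro g
    by_cases hg : g.1 0 0 ≠ 0 ∧ g.1 1 0 ≠ 0
    · calc _ ≤ ((Finset.range J).biUnion fun k => Finset.univ.filter fun s : F =>
            0 < k ∧ ((g * upperU s) ^ k).1 0 1 = 0).card := by
            apply Finset.card_le_card
            intro s hs
            obtain ⟨-, -, h⟩ := Finset.mem_filter.mp hs
            unfold PowGeneric at h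
            push Not at h
            obtain ⟨k, hk0, hkJ, h⟩ := h
            exact Finset.mem_biUnion.mpr ⟨k, Finset.mem_range.mpr hkJ, by simpa using ⟨hk0, h⟩⟩
        _ ≤ (Finset.range J).card * J := by
            apply Finset.card_biUnion_le_card_mul
            intro k hk
            rcases Nat.eq_zero_or_pos k with h0 | h0
            · simp [h0]
            · have := card_pow_apply_eq_zero_le hg.1 hg.2 h0
              have hkJ := Finset.mem_range.mp hk
              simp only [h0, true_and]
              omega
        _ = J ^ 2 := by rw [Finset.card_range, pow_two]
    · rw [Finset.card_eq_zero.mpr]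
      · exact Nat.zero_le _
      · rw [Finset.filter_eq_empty_iff]
        rintro s - ⟨h, -⟩
        apply hg
        have h0 := (mul_upperU_apply g s 0).1
        have h1 := (mul_upperU_apply g s 1).1
        rw [← h0, ← h1]
        exact h)
  have hrest : (Finset.univ.filter fun g : SL(2, F) =>
      (g.1 0 0 ≠ 0 ∧ g.1 1 0 ≠ 0) ∧ ¬ PowGeneric J g).card ≤ J ^ 2 * Fintype.card F ^ 2 := by
    have hq : 0 < Fintype.card F := Fintype.card_pos
    apply Nat.le_of_mul_le_mul_left _ hq
    calc _ ≤ _ := horb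
      _ ≤ J ^ 2 * Fintype.card F ^ 3 := Nat.mul_le_mul_left _ card_SL2_le
      _ = _ := by ring
  have hcov : (Finset.univ.filter fun g : SL(2, F) => ¬ PowGeneric J g) ⊆
      (Finset.univ.filter fun g : SL(2, F) => (g.1 0 0 ≠ 0 ∧ g.1 1 0 ≠ 0) ∧ ¬ PowGeneric J g) ∪
      ((Finset.univ.filter fun m : SL(2, F) => m.1 0 0 = 0) ∪
        (Finset.univ.filter fun m : SL(2, F) => m.1 1 0 = 0)) := by
    intro g hg
    simp only [Finset.mem_union, Finset.mem_filter, Finset.mem_univ, true_and] at hg ⊢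
    tauto
  have c1 := Finset.card_le_card hcov
  have c2 := Finset.card_union_le
    (Finset.univ.filter fun g : SL(2, F) => (g.1 0 0 ≠ 0 ∧ g.1 1 0 ≠ 0) ∧ ¬ PowGeneric J g)
    ((Finset.univ.filter fun m : SL(2, F) => m.1 0 0 = 0) ∪
        (Finset.univ.filter fun m : SL(2, F) => m.1 1 0 = 0))
  have c3 := Finset.card_union_le (Finset.univ.filter fun m : SL(2, F) => m.1 0 0 = 0)
    (Finset.univ.filter fun m : SL(2, F) => m.1 1 0 = 0)
  rw [add_mul]
  omega

open Classical in
/-- The transvections at points of the affine line that are not fixed by `g`. -/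
noncomputable def transvectionsOff (g : SL(2, F)) : Finset SL(2, F) :=
  ((Finset.univ.filter fun x : F => ¬ Fixes (some x) g) ×ˢ (Finset.univ.erase (0 : F))).image
    fun z => transvectionAt z.1 z.2

theorem mem_transvectionsOff {g u : SL(2, F)} :
    u ∈ transvectionsOff g ↔ ∃ x y : F, ¬ Fixes (some x) g ∧ y ≠ 0 ∧ transvectionAt x y = u := by
  classical
  simp [transvectionsOff, and_assoc]

theorem le_card_transvectionsOff {g : SL(2, F)} (hg : g.1 0 1 ≠ 0) :
    (Fintype.card F - 2) * (Fintype.card F - 1) ≤ (transvectionsOff g).card := by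
  classical
  rw [transvectionsOff, Finset.card_image_of_injOn, Finset.card_product,
    Finset.card_erase_of_mem (Finset.mem_univ _), Finset.card_univ]
  · apply Nat.mul_le_mul_right
    have h1 : (Finset.univ.filter fun x : F => Fixes (some x) g).card ≤ 2 := by
      apply card_le_two_of_quadratic _ (g.1 1 0) (g.1 1 1 - g.1 0 0) (-g.1 0 1)
      · rintro ⟨-, -, h⟩
        exact hg (neg_eq_zero.mp h)
      · intro x hx
        have := (fixes_some x g).mp (Finset.mem_filter.mp hx).2
        linear_combination this
    have h2 := Finset.card_filter_add_card_filter_not (s := (Finset.univ : Finset F))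
      (fun x => Fixes (some x) g)
    rw [Finset.card_univ] at h2
    omega
  · rintro ⟨x, y⟩ hxy ⟨x', y'⟩ _ h
    obtain ⟨-, hy⟩ := Finset.mem_product.mp (Finset.mem_coe.mp hxy)
    have hy0 : y ≠ 0 := (Finset.mem_erase.mp hy).1
    obtain ⟨a1, a2, a3, a4⟩ := transvectionAt_apply x y
    obtain ⟨b1, b2, b3, b4⟩ := transvectionAt_apply x' y'
    simp only at h
    rw [h] at a1 a3
    have ey : y = y' := by linear_combination a3 - b3
    subst ey
    have ex : x = x' := by
      apply mul_right_cancel₀ hy0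
      linear_combination a1 - b1
    rw [ex]

theorem tr_of_mem_transvectionsOff {g u : SL(2, F)} (hu : u ∈ transvectionsOff g) :
    SL2.tr u = 2 := by
  obtain ⟨x, y, -, -, rfl⟩ := mem_transvectionsOff.mp hu
  obtain ⟨a1, a2, a3, a4⟩ := transvectionAt_apply x y
  rw [SL2.tr, a1, a4]
  ring

/-- The translates for i < j overlap little: multiplied by g^i, a common element becomes a u for
which both u and g^(j-i)u have trace 2. -/
theorem card_biUnion_transvectionsOff {J : ℕ} (hJ : 1 < J) {g : SL(2, F)} (hg : PowGeneric J g) :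
    J * ((Fintype.card F - 2) * (Fintype.card F - 1)) ≤
      ((Finset.range J).biUnion fun j =>
        (transvectionsOff g).image fun u => (g ^ j)⁻¹ * u).card + J ^ 2 * (2 * Fintype.card F) := by
  apply mul_card_le_card_biUnion
  · intro j _
    rw [Finset.card_image_of_injective _ (mul_right_injective _)]
    apply le_card_transvectionsOff
    simpa using hg 1 one_pos hJ
  · intro i j hij hj
    have hm : (g ^ (j - i)).1 0 1 ≠ 0 := hg (j - i) (by omega) (by omega)
    rw [← Finset.card_image_of_injective _ (mul_right_injective (g ^ i))]
    apply card_tr_eq_two_le hm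
    intro u hu
    obtain ⟨h, hh, rfl⟩ := Finset.mem_image.mp hu
    obtain ⟨h1, h2⟩ := Finset.mem_inter.mp hh
    obtain ⟨u₁, hu₁, rfl⟩ := Finset.mem_image.mp h1
    obtain ⟨u₂, hu₂, e⟩ := Finset.mem_image.mp h2
    rw [mul_inv_cancel_left]
    refine ⟨tr_of_mem_transvectionsOff hu₁, ?_⟩
    have : g ^ (j - i) * u₁ = u₂ := by
      have e' : g ^ j * ((g ^ i)⁻¹ * u₁) = u₂ := by rw [← e, mul_inv_cancel_left]
      rw [← e', ← mul_assoc]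
      congr 1
      rw [eq_mul_inv_iff_mul_eq, ← pow_add]
      congr 1
      omega
    rw [this]
    exact tr_of_mem_transvectionsOff hu₂

/-- There are many generating pairs. -/
theorem le_card_generatingPairs {p : ℕ} [Fact p.Prime] {J : ℕ} (hJ : 1 < J)
    (hJp : 4 * (J ^ 2 + 2) ≤ p) :
    J * p ^ 5 ≤ 16 * (generatingPairs SL(2, ZMod p)).ncard := by
  classical
  have hcardp : Fintype.card (ZMod p) = p := ZMod.card p
  let T : Finset (Σ _ : SL(2, ZMod p), SL(2, ZMod p)) :=
    (Finset.univ.filter fun g : SL(2, ZMod p) => PowGeneric J g).sigma fun g =>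
      (Finset.range J).biUnion fun j => (transvectionsOff g).image fun u => (g ^ j)⁻¹ * u
  have hTle : T.card ≤ (generatingPairs SL(2, ZMod p)).ncard := by
    rw [← Set.ncard_coe_finset]
    apply Set.ncard_le_ncard_of_injOn (fun x => (x.1, x.2))
    · rintro ⟨g, h⟩ hx
      obtain ⟨-, h2⟩ := Finset.mem_sigma.mp (Finset.mem_coe.mp hx)
      obtain ⟨j, -, h3⟩ := Finset.mem_biUnion.mp h2
      obtain ⟨u, hu, h4⟩ := Finset.mem_image.mp h3
      obtain ⟨x, y, hx, hy, rfl⟩ := mem_transvectionsOff.mp hu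
      simp only at h4 hx
      have hg : g ∈ Subgroup.closure {g, h} := Subgroup.subset_closure (by simp)
      have hh : h ∈ Subgroup.closure {g, h} := Subgroup.subset_closure (by simp)
      -- By construction g^j h is a transvection at a point that g moves.
      have hmem : transvectionAt x y ∈ Subgroup.closure {g, h} := by
        have : transvectionAt x y = g ^ j * h := by rw [← h4, mul_inv_cancel_left]
        rw [this]
        exact mul_mem (pow_mem hg j) hh
      exact subgroup_eq_top_of_transvectionAt_mem hy hmem hg hx
    · rintro ⟨a, b⟩ _ ⟨a', b'⟩ _ h
      obtain ⟨h1, h2⟩ := Prod.mk.inj h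
      simp only at h1 h2
      rw [h1, h2]
  have hgood : p ^ 3 ≤ 4 * (Finset.univ.filter fun g : SL(2, ZMod p) => PowGeneric J g).card := by
    have h1 := card_not_powGeneric_le (F := ZMod p) J
    have h2 := Finset.card_filter_add_card_filter_not (s := (Finset.univ : Finset SL(2, ZMod p)))
      (fun g => PowGeneric J g)
    have h3 := card_pow_three_le_two_mul_card_SL2 (F := ZMod p)
    rw [Finset.card_univ] at h2
    rw [hcardp] at h1 h3
    have h4 : 4 * ((J ^ 2 + 2) * p ^ 2) ≤ p ^ 3 := by
      calc _ = 4 * (J ^ 2 + 2) * p ^ 2 := by ring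
        _ ≤ p * p ^ 2 := Nat.mul_le_mul_right _ hJp
        _ = p ^ 3 := by ring
    omega
  have hsec : ∀ g ∈ Finset.univ.filter fun g : SL(2, ZMod p) => PowGeneric J g, J * p ^ 2 ≤
      4 * ((Finset.range J).biUnion fun j =>
        (transvectionsOff g).image fun u => (g ^ j)⁻¹ * u).card := by
    intro g hg
    have h1 := card_biUnion_transvectionsOff hJ (Finset.mem_filter.mp hg).2
    rw [hcardp] at h1
    have h8 : 8 * J ≤ p := by nlinarith
    have h12 : 16 ≤ p := by omega
    have h2 : J ^ 2 * (2 * p) * 4 ≤ J * p ^ 2 := by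
      calc J ^ 2 * (2 * p) * 4 = J * (8 * J * p) := by ring
        _ ≤ J * (p * p) := by gcongr
        _ = J * p ^ 2 := by ring
    have h3 : J * p ^ 2 ≤ 2 * (J * ((p - 2) * (p - 1))) := by
      obtain ⟨r, rfl⟩ : ∃ r, p = r + 2 := ⟨p - 2, by omega⟩
      have : (r + 2) ^ 2 ≤ 2 * ((r + 2 - 2) * (r + 2 - 1)) := by
        simp only [Nat.add_sub_cancel, show r + 2 - 1 = r + 1 by omega]
        nlinarith
      calc J * (r + 2) ^ 2 ≤ J * (2 * ((r + 2 - 2) * (r + 2 - 1))) := Nat.mul_le_mul_left _ this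
        _ = _ := by ring
    omega
  have hsum : (Finset.univ.filter fun g : SL(2, ZMod p) => PowGeneric J g).card * (J * p ^ 2) ≤
      4 * T.card := by
    rw [Finset.card_sigma, Finset.mul_sum, ← smul_eq_mul]
    exact Finset.card_nsmul_le_sum _ _ _ hsec
  calc J * p ^ 5 = p ^ 3 * (J * p ^ 2) := by ring
    _ ≤ 4 * (Finset.univ.filter fun g : SL(2, ZMod p) => PowGeneric J g).card * (J * p ^ 2) :=
      Nat.mul_le_mul_right _ hgood
    _ = 4 * ((Finset.univ.filter fun g : SL(2, ZMod p) => PowGeneric J g).card * (J * p ^ 2)) := by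
      ring
    _ ≤ 4 * (4 * T.card) := Nat.mul_le_mul_left _ hsum
    _ ≤ 16 * (generatingPairs SL(2, ZMod p)).ncard := by omega

end GeneratingCount

/-! ### From products of letters to graph distance -/

section Diameter

open scoped Pointwise

variable {G : Type*} [Group G] [DecidableEq G]

/-- The symmetric set `{1, g, g⁻¹, h, h⁻¹}`. -/
def letters (x : G × G) : Finset G := {1, x.1, x.1⁻¹, x.2, x.2⁻¹}

theorem mem_letters {x : G × G} {s : G} :
    s ∈ letters x ↔ s = 1 ∨ s = x.1 ∨ s = x.1⁻¹ ∨ s = x.2 ∨ s = x.2⁻¹ := by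
  simp [letters]

theorem inv_mem_letters {x : G × G} {s : G} (hs : s ∈ letters x) : s⁻¹ ∈ letters x := by
  rw [mem_letters] at hs ⊢
  rcases hs with rfl | rfl | rfl | rfl | rfl <;> simp

theorem edist_mul_le_one {x : G × G} {s : G} (hs : s ∈ letters x) (v : G) :
    (leftCayleyGraph {x.1, x.2}).edist (s * v) v ≤ 1 := by
  by_cases hv : s * v = v
  · rw [hv]; simp
  apply le_of_eq
  rw [SimpleGraph.edist_eq_one_iff_adj, leftCayleyGraph, SimpleGraph.fromRel_adj]
  refine ⟨hv, ?_⟩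
  rcases mem_letters.mp hs with rfl | rfl | rfl | rfl | rfl
  · exact absurd (one_mul v) hv
  · exact Or.inl ⟨x.1, by simp, rfl⟩
  · exact Or.inr ⟨x.1, by simp, by simp⟩
  · exact Or.inl ⟨x.2, by simp, rfl⟩
  · exact Or.inr ⟨x.2, by simp, by simp⟩

theorem edist_mul_le {x : G × G} (r : ℕ) {m : G} (hm : m ∈ letters x ^ r) (v : G) :
    (leftCayleyGraph {x.1, x.2}).edist (m * v) v ≤ r := by
  induction r generalizing m with
  | zero =>
    rw [pow_zero, Finset.mem_one] at hm
    simp [hm]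
  | succ r ih =>
    rw [pow_succ'] at hm
    obtain ⟨s, hs, m', hm', rfl⟩ := Finset.mem_mul.mp hm
    calc _ ≤ (leftCayleyGraph {x.1, x.2}).edist (s * m' * v) (m' * v) +
          (leftCayleyGraph {x.1, x.2}).edist (m' * v) v := SimpleGraph.edist_triangle
      _ ≤ 1 + r := by
          rw [mul_assoc]
          exact add_le_add (edist_mul_le_one hs _) (ih hm')
      _ = ((r + 1 : ℕ) : ℕ∞) := by push_cast; rw [add_comm]

theorem ediam_le_of_letters_pow {x : G × G} (r : ℕ) (h : ∀ m, m ∈ letters x ^ r) :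
    (leftCayleyGraph {x.1, x.2}).ediam ≤ r := by
  apply SimpleGraph.ediam_le_of_edist_le
  intro u v
  have := edist_mul_le r (h (u * v⁻¹)) v
  rwa [inv_mul_cancel_right] at this

end Diameter

/-! ### Iterating growth -/

section Iteration

open scoped Pointwise

variable {F : Type*} [Field F]

theorem wordVal_mem_letters_pow [DecidableEq F] (x : SL(2, F) × SL(2, F)) (w : List Bool) :
    wordVal x w ∈ letters x ^ w.length := by
  induction w with
  | nil => simp [wordVal]
  | cons b w ih =>
    rw [wordVal_cons, List.length_cons, pow_succ']
    refine Finset.mul_mem_mul ?_ ih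
    rw [mem_letters]
    cases b <;> simp [letter]

theorem two_pow_le_card_letters_pow [Fintype F] [DecidableEq F] {n : ℕ} {x : SL(2, F) × SL(2, F)}
    (hx : GoodPair n x) : 2 ^ n ≤ (letters x ^ n).card := by
  have h : (Finset.univ : Finset (Fin n → Bool)).card ≤ (letters x ^ n).card := by
    apply Finset.card_le_card_of_injOn (fun w => wordVal x (List.ofFn w))
    · intro w _
      have := wordVal_mem_letters_pow x (List.ofFn w)
      rwa [List.length_ofFn] at this
    · exact hx.injective.injOn
  simpa using h

/-- The stabiliser of a point is a proper subgroup, since a conjugate of `lowerU 1` moves that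
point. -/
theorem exists_not_fixes {S : Set SL(2, F)} (hS : Subgroup.closure S = ⊤) (e : Option F) :
    ∃ a ∈ S, ¬ Fixes e a := by
  by_contra! hall
  have hfix : ∀ m ∈ Subgroup.closure S, Fixes e m := by
    intro m hm
    induction hm using Subgroup.closure_induction with
    | mem m hm => exact hall m hm
    | one => simp [Fixes]
    | mul a b _ _ ha hb =>
      have : (frame e)⁻¹ * (a * b) * frame e =
          ((frame e)⁻¹ * a * frame e) * ((frame e)⁻¹ * b * frame e) := by group
      rw [Fixes] at ha hb
      rw [Fixes, this, SL2.mul_apply, ha, hb]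
      ring
    | inv a _ ha =>
      have : (frame e)⁻¹ * a⁻¹ * frame e = ((frame e)⁻¹ * a * frame e)⁻¹ := by group
      rw [Fixes] at ha
      rw [Fixes, this, (SL2.inv_apply _).2.2.1, ha, neg_zero]
  have := hfix (frame e * lowerU 1 * (frame e)⁻¹) (by rw [hS]; trivial)
  have h2 : (frame e)⁻¹ * (frame e * lowerU 1 * (frame e)⁻¹) * frame e = lowerU 1 := by group
  rw [Fixes, h2, (lowerU_apply (1 : F)).2.2.1] at this
  exact one_ne_zero this

theorem closure_letters_pow [DecidableEq F] {x : SL(2, F) × SL(2, F)}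
    (hx : x ∈ generatingPairs SL(2, F)) {r : ℕ} (hr : 0 < r) :
    Subgroup.closure ((letters x ^ r : Finset SL(2, F)) : Set SL(2, F)) = ⊤ := by
  rw [eq_top_iff, ← show Subgroup.closure {x.1, x.2} = ⊤ from hx]
  apply Subgroup.closure_mono
  intro s hs
  have h1 : (1 : SL(2, F)) ∈ letters x := mem_letters.mpr (Or.inl rfl)
  have h2 := Finset.pow_subset_pow_right h1 (show 1 ≤ r from hr)
  rw [pow_one] at h2
  apply h2
  rw [mem_letters]
  rcases hs with rfl | rfl <;> simp

/-- While |A|⁴ ≤ 4p¹¹, each twelvefold product adds at least L/250 to log |A|. A thousand of them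
would add 4L, beyond the ceiling of about 11L/4. -/
theorem exists_letters_pow_large {p : ℕ} [Fact p.Prime] (hp : 8000 ≤ Real.log p) {n : ℕ}
    (hn : Real.log p ≤ 40 * (n * Real.log 2)) {x : SL(2, ZMod p) × SL(2, ZMod p)}
    (hx : GoodPair n x) (hgen : x ∈ generatingPairs SL(2, ZMod p)) :
    ∃ i ≤ 1000, 4 * p ^ 11 < (letters x ^ (n * 12 ^ i)).card ^ 4 := by
  by_contra! hsmall
  set L := Real.log p with hL
  let N : ℕ → ℕ := fun i => (letters x ^ (n * 12 ^ i)).card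
  have h1 : (1 : SL(2, ZMod p)) ∈ letters x := mem_letters.mpr (Or.inl rfl)
  have hnpos : 0 < n := by
    rcases Nat.eq_zero_or_pos n with rfl | h
    · norm_num at hn; linarith
    · exact h
  have hNpos : ∀ i, 0 < N i := fun i =>
    Finset.card_pos.mpr ⟨1, by simpa using Finset.pow_mem_pow h1 (n := n * 12 ^ i)⟩
  have hNpos' : ∀ i, (0 : ℝ) < N i := fun i => by exact_mod_cast hNpos i
  have hppos : (0 : ℝ) < p := by exact_mod_cast (Fact.out : p.Prime).pos
  have hlog2 : Real.log 2 ≤ 1 := by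
    have := Real.log_two_lt_d9
    linarith
  have hlog2' : 0 ≤ Real.log 2 := Real.log_nonneg (by norm_num)
  have h2F : (2 : ZMod p) ≠ 0 := by
    intro h
    have h' : ((2 : ℕ) : ZMod p) = 0 := by exact_mod_cast h
    rw [ZMod.natCast_eq_zero_iff] at h'
    have hple : p ≤ 2 := Nat.le_of_dvd (by norm_num) h'
    have : L ≤ Real.log 2 := Real.log_le_log hppos (by exact_mod_cast hple)
    linarith
  have hle : ∀ i ≤ 1000, 4 * Real.log (N i) ≤ 2 + 11 * L := by
    intro i hi
    have h : (N i : ℝ) ^ 4 ≤ 4 * (p : ℝ) ^ 11 := by exact_mod_cast hsmall i hi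
    have h' := Real.log_le_log (by have := hNpos' i; positivity) h
    rw [Real.log_pow, Real.log_mul (by norm_num) (by positivity), Real.log_pow,
      show (4 : ℝ) = 2 ^ 2 by norm_num, Real.log_pow] at h'
    push_cast at h'
    linarith
  have hgrow : ∀ i, 6 * Real.log (N i) ≤ 26 + 5 * Real.log (N (i + 1)) ∨
      6 * L + 3 * Real.log (N i) ≤ 26 + 5 * Real.log (N (i + 1)) := by
    intro i
    have hpos : 0 < n * 12 ^ i := by positivity
    have hsub := Finset.pow_subset_pow_right h1 (show 1 ≤ n * 12 ^ i from hpos)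
    rw [pow_one] at hsub
    have hg : x.1 ∈ letters x ^ (n * 12 ^ i) := hsub (mem_letters.mpr (Or.inr (Or.inl rfl)))
    have hcl := closure_letters_pow hgen hpos
    have := card_growth (A := letters x ^ (n * 12 ^ i)) h2F (hsub h1)
      (inv_mem_pow (fun a => inv_mem_letters) _) (fun e => exists_not_fixes hcl e) hcl hg
      hx.tr_ne_zero hx.tr_sq_ne_four
    rw [← pow_mul, mul_assoc, ← pow_succ, ZMod.card] at this
    have hN1 := hNpos' (i + 1)
    have hN0 := hNpos' i
    have hlogr : Real.log (2 ^ 26 * (N (i + 1) : ℝ) ^ 5) ≤ 26 + 5 * Real.log (N (i + 1)) := by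
      rw [Real.log_mul (by norm_num) (by positivity), Real.log_pow, Real.log_pow]
      push_cast
      linarith
    rcases this with h | h
    · left
      have h' : (N i : ℝ) ^ 6 ≤ 2 ^ 26 * (N (i + 1) : ℝ) ^ 5 := by exact_mod_cast h
      have := Real.log_le_log (by positivity) h'
      rw [Real.log_pow] at this
      push_cast at this
      linarith
    · right
      have h' : (p : ℝ) ^ 6 * (N i : ℝ) ^ 3 ≤ 2 ^ 26 * (N (i + 1) : ℝ) ^ 5 := by exact_mod_cast h
      have := Real.log_le_log (by positivity) h'
      rw [Real.log_mul (by positivity) (by positivity), Real.log_pow, Real.log_pow] at this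
      push_cast at this
      linarith
  have hmain : ∀ i ≤ 1000, L / 40 + i * (L / 250) ≤ Real.log (N i) := by
    intro i
    induction i with
    | zero =>
      intro _
      have h : (2 : ℝ) ^ n ≤ N 0 := by
        have := two_pow_le_card_letters_pow hx
        have e : N 0 = (letters x ^ n).card := by simp [N]
        rw [e]
        exact_mod_cast this
      have := Real.log_le_log (by positivity) h
      rw [Real.log_pow] at this
      simp only [Nat.cast_zero, zero_mul, add_zero]
      linarith
    | succ i ih =>
      intro hi
      have hi1 := ih (by omega)
      have hi2 := hle i (by omega)
      have hi0 : (0 : ℝ) ≤ i * (L / 250) := by positivity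
      push_cast
      -- In the first case the gain is at least L/200 - 26/5, since log |A| ≥ L/40; in the second it
      -- is at least L/10 - 27/5 by the ceiling. Both exceed L/250 because L ≥ 8000.
      rcases hgrow i with h | h <;> linarith
  have h1000 := hmain 1000 le_rfl
  have h1000' := hle 1000 le_rfl
  push_cast at h1000
  linarith

end Iteration

/-! ### Choice of parameters and conclusion -/

section Main

open scoped Pointwise

/-- The length of the words used to separate pairs over the field with `p` elements. -/
noncomputable def wordLength (p : ℕ) : ℕ := ⌊Real.log p / 24⌋₊

theorem exists_diam_bound : ∃ K : ℕ, 0 < K ∧ ∀ (p : ℕ) [Fact p.Prime], 8000 ≤ Real.log p →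
    ∀ x : SL(2, ZMod p) × SL(2, ZMod p), GoodPair (wordLength p) x →
      x ∈ generatingPairs SL(2, ZMod p) →
        (leftCayleyGraph {x.1, x.2}).ediam ≠ ⊤ ∧
          ((leftCayleyGraph {x.1, x.2}).diam : ℝ) ≤ K * Real.log p := by
  obtain ⟨K, hK0, hK⟩ : ∃ K : ℕ, 0 < K ∧ ∀ i ≤ 1000, 12 ^ i ≤ K :=
    ⟨12 ^ 1000, pow_pos (by norm_num) _, fun i hi => Nat.pow_le_pow_right (by norm_num) hi⟩
  refine ⟨2 * K, by omega, fun p _ hp x hx hgen => ?_⟩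
  set n := wordLength p with hn
  have hn1 : (n : ℝ) ≤ Real.log p / 24 := Nat.floor_le (by linarith)
  have hn2 : Real.log p / 24 < n + 1 := Nat.lt_floor_add_one _
  have hlog : Real.log p ≤ 40 * (n * Real.log 2) := by
    have h2 := Real.log_two_gt_d9
    have : (n : ℝ) * 0.69 ≤ n * Real.log 2 := by gcongr; linarith
    linarith
  obtain ⟨i, hi, hbig⟩ := exists_letters_pow_large hp hlog hx hgen
  have hall := mem_pow_of_large (inv_mem_pow (fun a => inv_mem_letters (x := x)) (n * 12 ^ i))
    (by rw [ZMod.card]; exact hbig)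
  rw [← pow_mul, ← pow_mul] at hall
  have hed := ediam_le_of_letters_pow (x := x) (n * 12 ^ i * (10 * 4)) hall
  have hne : (leftCayleyGraph {x.1, x.2}).ediam ≠ ⊤ :=
    ne_top_of_le_ne_top (ENat.natCast_ne_top _) hed
  refine ⟨hne, ?_⟩
  have hdiam : (leftCayleyGraph {x.1, x.2}).diam ≤ n * 12 ^ i * (10 * 4) := by
    rw [SimpleGraph.diam]
    exact ENat.toNat_le_of_le_natCast hed
  have hle : n * 12 ^ i * (10 * 4) ≤ n * K * (10 * 4) := by
    have := hK i hi
    gcongr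
  calc ((leftCayleyGraph {x.1, x.2}).diam : ℝ) ≤ (n * K * (10 * 4) : ℕ) := by
        exact_mod_cast hdiam.trans hle
    _ = n * (K * 40 : ℝ) := by push_cast; ring
    _ ≤ Real.log p / 24 * (K * 40 : ℝ) := by gcongr
    _ ≤ ((2 * K : ℕ) : ℝ) * Real.log p := by
        push_cast
        have : 0 ≤ (K : ℝ) * Real.log p := by positivity
        linarith

/-- The generating pairs that are not controlled by the growth argument. -/
def exceptionalPairs (p : ℕ) [Fact p.Prime] : Set (SL(2, ZMod p) × SL(2, ZMod p)) :=
  {x | x ∈ generatingPairs SL(2, ZMod p) ∧ (8000 ≤ Real.log p → ¬ GoodPair (wordLength p) x)}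

theorem ncard_exceptionalPairs_le {p : ℕ} [Fact p.Prime] (hp : 8000 ≤ Real.log p) :
    (exceptionalPairs p).ncard ≤ (wordLength p * 4 ^ wordLength p + 9) * p ^ 5 := by
  classical
  have h := card_not_goodPair_le (F := ZMod p) (wordLength p)
  rw [ZMod.card] at h
  refine le_trans ?_ h
  rw [← Set.ncard_coe_finset]
  apply Set.ncard_le_ncard _ (Set.toFinite _)
  intro x hx
  simpa using hx.2 hp

/-- With y = p^(1/8), the word length satisfies n4^n ≤ 8^n ≤ y, which is why log p is divided by 24.
So there are at most 10y p⁵ exceptional pairs, against at least y²p⁵/32 generating ones. -/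
theorem ncard_exceptionalPairs_le_mul {p : ℕ} [Fact p.Prime] (hp : 8000 ≤ Real.log p) {c : ℝ}
    (hc : 0 < c) (hcp : 320 / c ≤ Real.exp (Real.log p / 8)) :
    ((exceptionalPairs p).ncard : ℝ) ≤ c * (generatingPairs SL(2, ZMod p)).ncard := by
  have hppos : (0 : ℝ) < p := by exact_mod_cast (Fact.out : p.Prime).pos
  set y := Real.exp (Real.log p / 8) with hy
  have hy10 : 10 ≤ y := by
    have := Real.add_one_le_exp (Real.log p / 8)
    linarith
  have hpy : (p : ℝ) = y ^ 8 := by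
    rw [hy, ← Real.exp_nat_mul]
    push_cast
    rw [mul_div_cancel₀ _ (by norm_num), Real.exp_log hppos]
  set n := wordLength p with hn
  have hn1 : (n : ℝ) ≤ Real.log p / 24 := Nat.floor_le (by linarith)
  have h8 : (8 : ℝ) ^ n ≤ y := by
    have h2 : Real.log 2 ≤ 1 := by linarith [Real.log_two_lt_d9]
    have h2' : 0 ≤ Real.log 2 := Real.log_nonneg (by norm_num)
    rw [← Real.exp_log (show (0 : ℝ) < 8 ^ n by positivity), hy, Real.exp_le_exp, Real.log_pow,
      show (8 : ℝ) = 2 ^ 3 by norm_num, Real.log_pow]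
    push_cast
    have h1 : (n : ℝ) * (3 * Real.log 2) ≤ Real.log p / 24 * (3 * 1) := by gcongr
    linarith
  have hfac : ((n * 4 ^ n + 9 : ℕ) : ℝ) ≤ 10 * y := by
    have h1 : n * 4 ^ n ≤ 8 ^ n := by
      calc n * 4 ^ n ≤ 2 ^ n * 4 ^ n := Nat.mul_le_mul_right _ Nat.lt_two_pow_self.le
        _ = 8 ^ n := by rw [← mul_pow]; norm_num
    have h2 : ((n * 4 ^ n : ℕ) : ℝ) ≤ 8 ^ n := by exact_mod_cast h1
    push_cast at h2 ⊢
    linarith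
  -- J is about p^(1/4): it outgrows the factor y, while J² stays far below p.
  set J := ⌊y ^ 2⌋₊ with hJ
  have hJ1 : (J : ℝ) ≤ y ^ 2 := Nat.floor_le (by positivity)
  have hJ2 : y ^ 2 < J + 1 := Nat.lt_floor_add_one _
  have hJ3 : 1 < J := by
    have : (1 : ℝ) < J := by nlinarith
    exact_mod_cast this
  have hJp : 4 * (J ^ 2 + 2) ≤ p := by
    have h1 : (4 : ℝ) * (J ^ 2 + 2) ≤ p := by
      rw [hpy]
      have h3 : (100 : ℝ) ≤ y ^ 2 := by nlinarith
      have h4 : (1000 : ℝ) ≤ y ^ 4 := by nlinarith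
      calc (4 : ℝ) * (J ^ 2 + 2) ≤ 4 * ((y ^ 2) ^ 2 + 2) := by gcongr
        _ = 4 * y ^ 4 + 8 := by ring
        _ ≤ y ^ 4 * y ^ 4 := by nlinarith
        _ = y ^ 8 := by ring
    exact_mod_cast h1
  have hgen : (J : ℝ) * p ^ 5 ≤ 16 * (generatingPairs SL(2, ZMod p)).ncard := by
    exact_mod_cast le_card_generatingPairs hJ3 hJp
  have hexc : ((exceptionalPairs p).ncard : ℝ) ≤ ((n * 4 ^ n + 9 : ℕ) : ℝ) * p ^ 5 := by
    exact_mod_cast ncard_exceptionalPairs_le hp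
  have hcy : 320 ≤ c * y := by
    rw [div_le_iff₀ hc] at hcp
    linarith
  have hJy : y ^ 2 / 2 ≤ J := by nlinarith
  calc ((exceptionalPairs p).ncard : ℝ) ≤ ((n * 4 ^ n + 9 : ℕ) : ℝ) * p ^ 5 := hexc
    _ ≤ 10 * y * p ^ 5 := by gcongr
    _ = 320 * y / 32 * p ^ 5 := by ring
    _ ≤ c * y * y / 32 * p ^ 5 := by gcongr
    _ = c * (y ^ 2 / 2 * p ^ 5) / 16 := by ring
    _ ≤ c * (J * p ^ 5) / 16 := by gcongr
    _ ≤ c * (16 * (generatingPairs SL(2, ZMod p)).ncard) / 16 := by gcongr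
    _ = _ := by ring

/-- `diam` takes the value 0 when the extended diameter is infinite, so finiteness of `ediam` is a
separate conclusion. -/
theorem mainTheorem6 :
    ∃ C : ℝ, 0 < C ∧
      ∃ E : (p : Nat.Primes) → Set (SL(2, ZMod p) × SL(2, ZMod p)),
        (∀ p : Nat.Primes, E p ⊆ generatingPairs SL(2, ZMod p)) ∧
        (fun p : Nat.Primes => ((E p).ncard : ℝ)) =o[comap (fun p : Nat.Primes => (p : ℕ)) atTop]
          (fun p : Nat.Primes => ((generatingPairs SL(2, ZMod p)).ncard : ℝ)) ∧
        ∀ p : Nat.Primes, ∀ g h : SL(2, ZMod p),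
          (g, h) ∈ generatingPairs SL(2, ZMod p) → (g, h) ∉ E p →
            (leftCayleyGraph {g, h}).ediam ≠ ⊤ ∧
            ((leftCayleyGraph {g, h}).diam : ℝ) ≤ C * Real.log (p : ℕ) := by
  obtain ⟨K, hK0, hK⟩ := exists_diam_bound
  refine ⟨K, by exact_mod_cast hK0,
    -- When log p < 8000 every generating pair is exceptional, so the diameter bound is vacuous for
    -- these finitely many primes and the asymptotics are unaffected.
    fun p => haveI : Fact (p : ℕ).Prime := ⟨p.2⟩; exceptionalPairs p, ?_, ?_, ?_⟩
  · intro p x hx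
    exact hx.1
  · rw [isLittleO_iff]
    intro c hc
    have hlog : Tendsto (fun p : Nat.Primes => Real.log (p : ℕ))
        (comap (fun p : Nat.Primes => (p : ℕ)) atTop) atTop :=
      Real.tendsto_log_atTop.comp (tendsto_natCast_atTop_atTop.comp tendsto_comap)
    have hexp : Tendsto (fun p : Nat.Primes => Real.exp (Real.log (p : ℕ) / 8))
        (comap (fun p : Nat.Primes => (p : ℕ)) atTop) atTop :=
      Real.tendsto_exp_atTop.comp (Tendsto.atTop_div_const (by norm_num) hlog)
    filter_upwards [hlog.eventually_ge_atTop 8000, hexp.eventually_ge_atTop (320 / c)] with p h1 h2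
    have : Fact (p : ℕ).Prime := ⟨p.2⟩
    rw [Real.norm_natCast, Real.norm_natCast]
    exact ncard_exceptionalPairs_le_mul h1 hc h2
  · intro p g h hgen hE
    have : Fact (p : ℕ).Prime := ⟨p.2⟩
    have hE' : ¬ ((g, h) ∈ generatingPairs SL(2, ZMod p) ∧
        (8000 ≤ Real.log (p : ℕ) → ¬ GoodPair (wordLength p) (g, h))) := hE
    push Not at hE'
    obtain ⟨h1, h2⟩ := hE' hgen
    exact hK p h1 (g, h) h2 hgen

end Main
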